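/- **Setting (Pirouette).** Terms are taken up to renaming of bound variables. Fix a set of locations $\ell$ and a local expression language with variables, capture-avoiding substitution obeying the usual equations, a step relation $e\to e'$, and a predicate "$v$ is a value", such that values are closed and do not step and $\mathsf{true},\mathsf{false}$ are values. Let $d\in\{\mathsf L,\mathsf R\}$. *Choreographies* (each location has its own local variables): $$C ::= X \mid \ell.e \mid \ell_1.e\to\ell_2.x;C \mid \mathsf{if}\ \ell.e\ \mathsf{then}\ C_1\ \mathsf{else}\ C_2 \mid \ell_1[d]\to\ell_2;C \mid \mathsf{let}\ \ell.x:=C_1\ \mathsf{in}\ C_2 \mid \mathsf{fun}_\ell\,F(x):=C \mid \mathsf{fun}\,F(X):=C \mid C\ \ell.e \mid C_1\,C_2 .$$ $\mathrm{LN}(C)$ is the set of locations occurring in $C$. Values are $\ell.v$ ($v$ a local value) and closed functions. *Steps* $C\xrightarrow{R}_B C'$, with redex $R$ and set $B$ of blocked locations. Here $e_1\to e_2$ and $v$ is a local value. - Local steps, whose acting location $\ell$ (respectively $\ell_1$) must not be in $B$: $\ell.e_1\to\ell.e_2$ with redex $\mathsf{Done}(\ell,e_1,e_2)$; the condition of an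 $\mathsf{if}$ at $\ell$ with $\mathsf{IfE}(\ell,e_1,e_2)$; the argument of $C\ \ell.e_1$ with $\mathsf{AppLocalE}(\ell,e_1,e_2)$; the message of $\ell_1.e_1\to\ell_2.x;C$, if $\ell_1\neq\ell_2$, with $\mathsf{SendE}(\ell_1,e_1,e_2,\ell_2)$; and an $\mathsf{if}$ on $\mathsf{true}$ or $\mathsf{false}$ at $\ell$ steps to its first or second branch with $\mathsf{IfT}(\ell)$ or $\mathsf{IfF}(\ell)$. - Communication, for $\ell_1,\ell_2\notin B$, $\ell_1\neq\ell_2$: $\ell_1.v\to\ell_2.x;C$ steps to $C[\ell_2.x\mapsto v]$ with $\mathsf{SendV}(\ell_1,v,\ell_2)$; $\ell_1[d]\to\ell_2;C$ steps to $C$ with $\mathsf{Sync}(\ell_1,d,\ell_2)$. - Under a prefix, out of order: the continuation of a send or synchronization between $\ell_1,\ell_2$ may step with the same $R$ when $\{\ell_1,\ell_2\}$ is added to $B$; both branches of an $\mathsf{if}$ at $\ell$ may step together with the same $R$ when $\ell$ is added to $B$. - In a function position, $R$ becomes $\mathsf{Fun}(R)$; in the argument of $C_1\,C_2$ or in the bound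 part $C_1$ of a $\mathsf{let}$ it becomes $\mathsf{Arg}(R)$; $B$ is unchanged. - $\beta$-steps, only for $B=\emptyset$: $\mathsf{let}\ \ell.x:=\ell.v\ \mathsf{in}\ C$ to $C[\ell.x\mapsto v]$ with $\mathsf{DefLocal}(\ell,v)$; $(\mathsf{fun}_\ell F(x):=C)\ \ell.v$ to $C[\ell.x\mapsto v][F\mapsto\mathsf{fun}_\ell F(x):=C]$ with $\mathsf{AppLocal}(\ell,v)$; $(\mathsf{fun}\,F(X):=C)\,V$, $V$ a value, to $C[X\mapsto V,F\mapsto\mathsf{fun}\,F(X):=C]$ with $\mathsf{AppGlobal}$. *Control programs* $$E::= X\mid \mathsf{fun}_{\mathsf{loc}}F(x):=E\mid \mathsf{fun}\,F(X):=E\mid E\,e\mid E_1\,E_2\mid ()\mid \mathsf{ret}\,e\mid \mathsf{let\ ret}\,x=E_1\ \mathsf{in}\ E_2\mid \mathsf{send}\,e\,\mathsf{to}\,\ell;E\mid \mathsf{recv}\,x\,\mathsf{from}\,\ell;E\mid \mathsf{if}\,e\,\mathsf{then}\,E_1\,\mathsf{else}\,E_2\mid \mathsf{choose}\,d\,\mathsf{for}\,\ell;E\mid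 \mathsf{allow}\,\ell\,\{\cdots\},$$ where an external choice $\mathsf{allow}\,\ell$ offers a branch $\mathsf L\Rightarrow E_1$, a branch $\mathsf R\Rightarrow E_2$, or both. Values are $()$, $\mathsf{ret}\,v$ and closed functions. Steps $E\xrightarrow{l}E'$ have labels: $\iota$ (a local step of the expression at the head of a $\mathsf{ret}$, $\mathsf{if}$, $\mathsf{send}$ or as argument in $E\,e$; an $\mathsf{if}$ on $\mathsf{true}$ or $\mathsf{false}$); $!(v,\ell)$ (sending the value $v$ to $\ell$); $?(\ell,v)$ (receiving any value $v$ from $\ell$, which substitutes $v$ for $x$); $\mathsf{ch}(d,\ell)$ (choosing $d$ for $\ell$); $\mathsf{al}(\ell,d)$ (letting $\ell$ select an offered branch $d$); $\iota_{\mathsf{sync}}$ (the $\beta$-steps of $\mathsf{let\ ret}\,x=\mathsf{ret}\,v$ and of the two kinds of recursive functions applied to a value, which also substitute the function for its name $F$); $\mathsf{Fun}(l)$ and $\mathsf{Arg}(l)$ (a step $l$ in function position; in the argument of $E_1\,E_2$ or in the bound part of a $\mathsf{let\ ret}$). *Label merge* $l_1\cdot l_2\Rightarrow S$ is the least relation with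 $\iota\cdot\iota\Rightarrow\iota$, $\iota_{\mathsf{sync}}\cdot\iota_{\mathsf{sync}}\Rightarrow\iota_{\mathsf{sync}}$, $!(v,\ell_2)\cdot{?}(\ell_1,v)\Rightarrow\mathsf{Comm}(\ell_1,v,\ell_2)$, $\mathsf{ch}(d,\ell_2)\cdot\mathsf{al}(\ell_1,d)\Rightarrow\mathsf{Choice}(\ell_1,d,\ell_2)$, and closed under applying $\mathsf{Fun}$, or $\mathsf{Arg}$, to both $l_1$ and $l_2$. *Endpoint projection* $[\![C]\!]_\ell$ (partial) keeps variables, global functions and global applications. For $\ell'=\ell$ it maps $\ell'.e$, $\mathsf{if}$, $\mathsf{let}$, local functions and local applications at $\ell'$ to the corresponding control constructs. For $\ell'\neq\ell$ it maps $\ell'.e$ to $()$; an $\mathsf{if}$ at $\ell'$ to the merge of the projected branches; $\mathsf{let}\ \ell'.x:=C_1\ \mathsf{in}\ C_2$ to $(\mathsf{fun}\,F(X):=[\![C_2]\!]_\ell)\,[\![C_1]\!]_\ell$ with $F,X$ fresh; $\mathsf{fun}_{\ell'}F(x):=C$ to $\mathsf{fun}\,F(X):=[\![C]\!]_\ell$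 with $X$ fresh; and $C\ \ell'.e$ to $[\![C]\!]_\ell\,()$. A send or synchronization from $\ell_1$ to $\ell_2$ becomes $\mathsf{send}$, respectively $\mathsf{choose}$, at $\ell=\ell_1\ne\ell_2$; it becomes $\mathsf{recv}$, respectively the one-branch $\mathsf{allow}\,\ell_1\{d\Rightarrow\cdots\}$, at $\ell=\ell_2\neq\ell_1$; it is undefined at $\ell=\ell_1=\ell_2$, and is skipped at other locations. The merge of two control programs is partial: both must have the same structure with the same expressions and locations, and subprograms are merged recursively (functions must be identical), except that external choices of the same location may offer different branches; then all of them are offered, and the branches that both offer are merged. *Projection of redices* $[\![R]\!]_\ell$ (partial): $\mathsf{Done},\mathsf{IfE},\mathsf{IfT},\mathsf{IfF},\mathsf{AppLocalE},\mathsf{SendE}$ project to $\iota$ at their acting location (the sender, for $\mathsf{SendE}$); for $\ell_1\neq\ell_2$, $\mathsf{SendV}(\ell_1,v,\ell_2)$ projects to $!(v,\ell_2)$ at $\ell_1$ and to $?(\ell_1,v)$ at $\ell_2$, and $\mathsf{Sync}(\ell_1,d,\ell_2)$ to $\mathsf{ch}(d,\ell_2)$ at $\ell_1$ and to $\mathsf{al}(\ell_1,d)$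 at $\ell_2$; the three $\beta$-redices project to $\iota_{\mathsf{sync}}$ everywhere; $\mathsf{Fun}$ and $\mathsf{Arg}$ commute with projection; all other cases are undefined. **Theorem (Local Soundness).** For every choreography $C_1$ the following hold. (A statement about a projection includes that it is defined.) 1. If $[\![C_1]\!]_\ell\xrightarrow{l}E$ and $l\cdot l\Rightarrow\iota$, then there are $R$ and $C_2$ with $[\![R]\!]_\ell=l$, $[\![C_2]\!]_\ell=E$ and $C_1\xrightarrow{R}_{\emptyset}C_2$. 2. If $[\![C_1]\!]_{\ell_1}\xrightarrow{l_1}E_1$, $[\![C_1]\!]_{\ell_2}\xrightarrow{l_2}E_2$ and $l_1\cdot l_2\Rightarrow\mathsf{Comm}(\ell_1,v,\ell_2)$, then there are $R$ and $C_2$ with $[\![C_2]\!]_{\ell_1}=E_1$, $[\![C_2]\!]_{\ell_2}=E_2$, $[\![R]\!]_{\ell_1}=l_1$, $[\![R]\!]_{\ell_2}=l_2$ and $C_1\xrightarrow{R}_{\emptyset}C_2$. 3. If $[\![C_1]\!]_{\ell_1}\xrightarrow{l_1}E_1$, $[\![C_1]\!]_{\ell_2}\xrightarrow{l_2}E_2$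 and $l_1\cdot l_2\Rightarrow\mathsf{Choice}(\ell_1,d,\ell_2)$, then there are $R$ and $C_2$ with $[\![C_2]\!]_{\ell_1}=E_1$, $[\![C_2]\!]_{\ell_2}=E_2$, $[\![R]\!]_{\ell_1}=l_1$, $[\![R]\!]_{\ell_2}=l_2$ and $C_1\xrightarrow{R}_{\emptyset}C_2$. 4. If $\mathfrak L$ is a nonempty set of locations with $\mathrm{LN}(C_1)\subseteq\mathfrak L$, if $l\cdot l\Rightarrow\iota_{\mathsf{sync}}$, and if $[\![C_1]\!]_\ell\xrightarrow{l}E_\ell$ for every $\ell\in\mathfrak L$, then there are $R$ and $C_2$ with $[\![R]\!]_\ell=l$ and $[\![C_2]\!]_\ell=E_\ell$ for every $\ell\in\mathfrak L$, and $C_1\xrightarrow{R}_{\emptyset}C_2$. -/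

import Mathlib

universe u v

namespace Pirouette

/-! ### The local language

Variables are de Bruijn indices, so that terms are taken up to renaming of bound variables. -/

/-- A local (message) language.  `ClosedBelow n e` says that every free variable of `e` has index
less than `n`; `subst e σ` is the parallel substitution of `σ n` for every variable `n`. -/
structure LocalLanguage where
  Expr : Type v
  var : ℕ → Expr
  ClosedBelow : ℕ → Expr → Prop
  subst : Expr → (ℕ → Expr) → Expr
  rename : Expr → (ℕ → ℕ) → Expr
  IsValue : Expr → Prop
  tt : Expr
  ff : Expr
  Step : Expr → Expr → Prop
  closedBelow_var : ∀ n m, ClosedBelow n (var m) ↔ m < n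
  subst_var : ∀ n σ, subst (var n) σ = σ n
  subst_id : ∀ e, subst e var = e
  subst_subst : ∀ e σ₁ σ₂, subst (subst e σ₁) σ₂ = subst e (fun n => subst (σ₁ n) σ₂)
  rename_eq_subst : ∀ e ξ, rename e ξ = subst e (fun n => var (ξ n))
  subst_of_closedBelow : ∀ n e σ, ClosedBelow n e → (∀ m < n, σ m = var m) → subst e σ = e
  isValue_closed : ∀ e, IsValue e → ClosedBelow 0 e
  isValue_tt : IsValue tt
  isValue_ff : IsValue ff
  isValue_not_step : ∀ e₁ e₂, IsValue e₁ → ¬ Step e₁ e₂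

namespace LocalLanguage

variable (L : LocalLanguage.{v})

/-- The substitution `σ` moved under one binder. -/
def up (σ : ℕ → L.Expr) : ℕ → L.Expr
  | 0 => L.var 0
  | n + 1 => L.rename (σ n) Nat.succ

/-- The substitution that replaces the variable bound last by `e`, and removes that binder. -/
def single (e : L.Expr) : ℕ → L.Expr
  | 0 => e
  | n + 1 => L.var n

/-- The substitution that makes room for one new bound variable. -/
def shift : ℕ → L.Expr := fun n => L.var (n + 1)

end LocalLanguage

/-- Synchronization labels. -/
inductive SyncLabel
  | left
  | right

/-- A renaming moved under one binder. -/
def upRen (ξ : ℕ → ℕ) : ℕ → ℕ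
  | 0 => 0
  | n + 1 => ξ n + 1

/-! ### Choreographies -/

/-- Choreographies.  Every location has its own namespace of local variables.  Binders:
* `send ℓ₁ e ℓ₂ C` (`ℓ₁.e → ℓ₂.x; C`) binds the local variable `0` of `ℓ₂` in `C`;
* `defLocal ℓ C₁ C₂` (`let ℓ.x := C₁ in C₂`) binds the local variable `0` of `ℓ` in `C₂`;
* `funLocal ℓ C` (`fun_ℓ F(x) := C`) binds in `C` the local variable `0` of `ℓ`, which is the
  argument `x`, and the choreography variable `0`, which is the function `F` itself;
* `funGlobal C` (`fun F(X) := C`) binds in `C` the choreography variable `0`, which is the argument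
  `X`, and the choreography variable `1`, which is the function `F` itself. -/
inductive Chor (Loc : Type u) (L : LocalLanguage.{v})
  | var (X : ℕ)
  | done (ℓ : Loc) (e : L.Expr)
  | send (ℓ₁ : Loc) (e : L.Expr) (ℓ₂ : Loc) (C : Chor Loc L)
  | ite (ℓ : Loc) (e : L.Expr) (C₁ C₂ : Chor Loc L)
  | sync (ℓ₁ : Loc) (d : SyncLabel) (ℓ₂ : Loc) (C : Chor Loc L)
  | defLocal (ℓ : Loc) (C₁ C₂ : Chor Loc L)
  | funLocal (ℓ : Loc) (C : Chor Loc L)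
  | funGlobal (C : Chor Loc L)
  | appLocal (ℓ : Loc) (C : Chor Loc L) (e : L.Expr)
  | appGlobal (C₁ C₂ : Chor Loc L)

namespace Chor

variable {Loc : Type u} {L : LocalLanguage.{v}}

/-- The set of location names that occur in a choreography. -/
def locationNames : Chor Loc L → Set Loc
  | var _ => ∅
  | done ℓ _ => {ℓ}
  | send ℓ₁ _ ℓ₂ C => {ℓ₁, ℓ₂} ∪ C.locationNames
  | ite ℓ _ C₁ C₂ => {ℓ} ∪ C₁.locationNames ∪ C₂.locationNames
  | sync ℓ₁ _ ℓ₂ C => {ℓ₁, ℓ₂} ∪ C.locationNames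
  | defLocal ℓ C₁ C₂ => {ℓ} ∪ C₁.locationNames ∪ C₂.locationNames
  | funLocal ℓ C => {ℓ} ∪ C.locationNames
  | funGlobal C => C.locationNames
  | appLocal ℓ C _ => {ℓ} ∪ C.locationNames
  | appGlobal C₁ C₂ => C₁.locationNames ∪ C₂.locationNames

open scoped Classical in
/-- Every free choreography variable has index less than `n`, and every free local variable of a
location `ℓ` has index less than `k ℓ`. -/
def ClosedBelow : Chor Loc L → ℕ → (Loc → ℕ) → Prop
  | var X, n, _ => X < n
  | done ℓ e, _, k => L.ClosedBelow (k ℓ) e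
  | send ℓ₁ e ℓ₂ C, n, k =>
      L.ClosedBelow (k ℓ₁) e ∧ C.ClosedBelow n (Function.update k ℓ₂ (k ℓ₂ + 1))
  | ite ℓ e C₁ C₂, n, k => L.ClosedBelow (k ℓ) e ∧ C₁.ClosedBelow n k ∧ C₂.ClosedBelow n k
  | sync _ _ _ C, n, k => C.ClosedBelow n k
  | defLocal ℓ C₁ C₂, n, k =>
      C₁.ClosedBelow n k ∧ C₂.ClosedBelow n (Function.update k ℓ (k ℓ + 1))
  | funLocal ℓ C, n, k => C.ClosedBelow (n + 1) (Function.update k ℓ (k ℓ + 1))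
  | funGlobal C, n, k => C.ClosedBelow (n + 2) k
  | appLocal ℓ C e, n, k => C.ClosedBelow n k ∧ L.ClosedBelow (k ℓ) e
  | appGlobal C₁ C₂, n, k => C₁.ClosedBelow n k ∧ C₂.ClosedBelow n k

/-- A choreography without free variables of either kind. -/
def Closed (C : Chor Loc L) : Prop := C.ClosedBelow 0 (fun _ => 0)

/-- Choreography values: local values, and closed functions. -/
inductive IsValue : Chor Loc L → Prop
  | done (ℓ : Loc) (v : L.Expr) : L.IsValue v → IsValue (done ℓ v)
  | funLocal (ℓ : Loc) (C : Chor Loc L) : (funLocal ℓ C).Closed → IsValue (funLocal ℓ C)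
  | funGlobal (C : Chor Loc L) : (funGlobal C).Closed → IsValue (funGlobal C)

open scoped Classical in
/-- The local substitution `σ` moved under a binder for a local variable of `ℓ'`, where `σ` acts on
the local variables of `ℓ`. -/
noncomputable def upAt (ℓ ℓ' : Loc) (σ : ℕ → L.Expr) : ℕ → L.Expr :=
  if ℓ = ℓ' then L.up σ else σ

open scoped Classical in
/-- The action of a substitution `σ` for the local variables of `ℓ` on an expression of `ℓ'`. -/
noncomputable def exprSubstAt (ℓ ℓ' : Loc) (σ : ℕ → L.Expr) (e : L.Expr) : L.Expr :=
  if ℓ = ℓ' then L.subst e σ else e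

/-- Local substitution: `σ` replaces the local variables of `ℓ`. -/
noncomputable def localSubst (ℓ : Loc) : Chor Loc L → (ℕ → L.Expr) → Chor Loc L
  | var X, _ => var X
  | done ℓ' e, σ => done ℓ' (exprSubstAt ℓ ℓ' σ e)
  | send ℓ₁ e ℓ₂ C, σ => send ℓ₁ (exprSubstAt ℓ ℓ₁ σ e) ℓ₂ (localSubst ℓ C (upAt ℓ ℓ₂ σ))
  | ite ℓ' e C₁ C₂, σ =>
      ite ℓ' (exprSubstAt ℓ ℓ' σ e) (localSubst ℓ C₁ σ) (localSubst ℓ C₂ σ)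
  | sync ℓ₁ d ℓ₂ C, σ => sync ℓ₁ d ℓ₂ (localSubst ℓ C σ)
  | defLocal ℓ' C₁ C₂, σ => defLocal ℓ' (localSubst ℓ C₁ σ) (localSubst ℓ C₂ (upAt ℓ ℓ' σ))
  | funLocal ℓ' C, σ => funLocal ℓ' (localSubst ℓ C (upAt ℓ ℓ' σ))
  | funGlobal C, σ => funGlobal (localSubst ℓ C σ)
  | appLocal ℓ' C e, σ => appLocal ℓ' (localSubst ℓ C σ) (exprSubstAt ℓ ℓ' σ e)
  | appGlobal C₁ C₂, σ => appGlobal (localSubst ℓ C₁ σ) (localSubst ℓ C₂ σ)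

/-- Renaming of choreography variables. -/
def rename : Chor Loc L → (ℕ → ℕ) → Chor Loc L
  | var X, ξ => var (ξ X)
  | done ℓ e, _ => done ℓ e
  | send ℓ₁ e ℓ₂ C, ξ => send ℓ₁ e ℓ₂ (C.rename ξ)
  | ite ℓ e C₁ C₂, ξ => ite ℓ e (C₁.rename ξ) (C₂.rename ξ)
  | sync ℓ₁ d ℓ₂ C, ξ => sync ℓ₁ d ℓ₂ (C.rename ξ)
  | defLocal ℓ C₁ C₂, ξ => defLocal ℓ (C₁.rename ξ) (C₂.rename ξ)
  | funLocal ℓ C, ξ => funLocal ℓ (C.rename (upRen ξ))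
  | funGlobal C, ξ => funGlobal (C.rename (upRen (upRen ξ)))
  | appLocal ℓ C e, ξ => appLocal ℓ (C.rename ξ) e
  | appGlobal C₁ C₂, ξ => appGlobal (C₁.rename ξ) (C₂.rename ξ)

/-- A substitution for choreography variables moved under a binder for a choreography variable. -/
def up (σ : ℕ → Chor Loc L) : ℕ → Chor Loc L
  | 0 => var 0
  | n + 1 => (σ n).rename Nat.succ

/-- A substitution for choreography variables moved under a binder for a local variable of `ℓ`. -/
noncomputable def upLocal (ℓ : Loc) (σ : ℕ → Chor Loc L) : ℕ → Chor Loc L :=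
  fun n => localSubst ℓ (σ n) L.shift

/-- Parallel, capture-avoiding substitution for choreography variables. -/
noncomputable def subst : Chor Loc L → (ℕ → Chor Loc L) → Chor Loc L
  | var X, σ => σ X
  | done ℓ e, _ => done ℓ e
  | send ℓ₁ e ℓ₂ C, σ => send ℓ₁ e ℓ₂ (C.subst (upLocal ℓ₂ σ))
  | ite ℓ e C₁ C₂, σ => ite ℓ e (C₁.subst σ) (C₂.subst σ)
  | sync ℓ₁ d ℓ₂ C, σ => sync ℓ₁ d ℓ₂ (C.subst σ)
  | defLocal ℓ C₁ C₂, σ => defLocal ℓ (C₁.subst σ) (C₂.subst (upLocal ℓ σ))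
  | funLocal ℓ C, σ => funLocal ℓ (C.subst (up (upLocal ℓ σ)))
  | funGlobal C, σ => funGlobal (C.subst (up (up σ)))
  | appLocal ℓ C e, σ => appLocal ℓ (C.subst σ) e
  | appGlobal C₁ C₂, σ => appGlobal (C₁.subst σ) (C₂.subst σ)

/-- The substitution `[F ↦ D]` for the one choreography variable bound last. -/
def single (D : Chor Loc L) : ℕ → Chor Loc L
  | 0 => D
  | n + 1 => var n

/-- The substitution `[X ↦ V, F ↦ D]` for the two choreography variables bound last. -/
def double (V D : Chor Loc L) : ℕ → Chor Loc L
  | 0 => V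
  | 1 => D
  | n + 2 => var n

end Chor

/-- Redices: the labels of choreography steps. -/
inductive Redex (Loc : Type u) (L : LocalLanguage.{v})
  | done (ℓ : Loc) (e₁ e₂ : L.Expr)
  | ifE (ℓ : Loc) (e₁ e₂ : L.Expr)
  | ifT (ℓ : Loc)
  | ifF (ℓ : Loc)
  | sendE (ℓ₁ : Loc) (e₁ e₂ : L.Expr) (ℓ₂ : Loc)
  | sendV (ℓ₁ : Loc) (v : L.Expr) (ℓ₂ : Loc)
  | sync (ℓ₁ : Loc) (d : SyncLabel) (ℓ₂ : Loc)
  | defLocal (ℓ : Loc) (v : L.Expr)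
  | appLocalE (ℓ : Loc) (e₁ e₂ : L.Expr)
  | appLocal (ℓ : Loc) (v : L.Expr)
  | appGlobal
  | arg (R : Redex Loc L)
  | func (R : Redex Loc L)

/-- The block-set semantics: `ChorStep R B C₁ C₂` says that `C₁` can step to `C₂` by the redex `R`
while all locations of `B` are blocked. -/
inductive ChorStep {Loc : Type u} {L : LocalLanguage.{v}} :
    Redex Loc L → Set Loc → Chor Loc L → Chor Loc L → Prop
  | doneE {B ℓ e₁ e₂} : ℓ ∉ B → L.Step e₁ e₂ →
      ChorStep (.done ℓ e₁ e₂) B (.done ℓ e₁) (.done ℓ e₂)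
  | sendE {B ℓ₁ ℓ₂ e₁ e₂ C} : ℓ₁ ∉ B → ℓ₁ ≠ ℓ₂ → L.Step e₁ e₂ →
      ChorStep (.sendE ℓ₁ e₁ e₂ ℓ₂) B (.send ℓ₁ e₁ ℓ₂ C) (.send ℓ₁ e₂ ℓ₂ C)
  | sendI {R B ℓ₁ ℓ₂ e C₁ C₂} : ChorStep R (B ∪ {ℓ₁, ℓ₂}) C₁ C₂ →
      ChorStep R B (.send ℓ₁ e ℓ₂ C₁) (.send ℓ₁ e ℓ₂ C₂)
  | sendV {B ℓ₁ ℓ₂ v C} : ℓ₁ ∉ B → ℓ₂ ∉ B → L.IsValue v → ℓ₁ ≠ ℓ₂ →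
      ChorStep (.sendV ℓ₁ v ℓ₂) B (.send ℓ₁ v ℓ₂ C) (C.localSubst ℓ₂ (L.single v))
  | ifE {B ℓ e₁ e₂ C₁ C₂} : ℓ ∉ B → L.Step e₁ e₂ →
      ChorStep (.ifE ℓ e₁ e₂) B (.ite ℓ e₁ C₁ C₂) (.ite ℓ e₂ C₁ C₂)
  | ifI {R B ℓ e C₁ C₂ C₁' C₂'} :
      ChorStep R (B ∪ {ℓ}) C₁ C₁' → ChorStep R (B ∪ {ℓ}) C₂ C₂' →
      ChorStep R B (.ite ℓ e C₁ C₂) (.ite ℓ e C₁' C₂')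
  | ifT {B ℓ C₁ C₂} : ℓ ∉ B → ChorStep (.ifT ℓ) B (.ite ℓ L.tt C₁ C₂) C₁
  | ifF {B ℓ C₁ C₂} : ℓ ∉ B → ChorStep (.ifF ℓ) B (.ite ℓ L.ff C₁ C₂) C₂
  | syncI {R B ℓ₁ d ℓ₂ C₁ C₂} : ChorStep R (B ∪ {ℓ₁, ℓ₂}) C₁ C₂ →
      ChorStep R B (.sync ℓ₁ d ℓ₂ C₁) (.sync ℓ₁ d ℓ₂ C₂)
  | sync {B ℓ₁ d ℓ₂ C} : ℓ₁ ∉ B → ℓ₂ ∉ B → ℓ₁ ≠ ℓ₂ →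
      ChorStep (.sync ℓ₁ d ℓ₂) B (.sync ℓ₁ d ℓ₂ C) C
  | defLocalI {R B ℓ C₁ C₁' C₂} : ChorStep R B C₁ C₁' →
      ChorStep (.arg R) B (.defLocal ℓ C₁ C₂) (.defLocal ℓ C₁' C₂)
  | defLocal {ℓ v C} : L.IsValue v →
      ChorStep (.defLocal ℓ v) ∅ (.defLocal ℓ (.done ℓ v) C) (C.localSubst ℓ (L.single v))
  | appLocalFun {R B ℓ C₁ C₂ e} : ChorStep R B C₁ C₂ →
      ChorStep (.func R) B (.appLocal ℓ C₁ e) (.appLocal ℓ C₂ e)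
  | appLocalArg {B ℓ C e₁ e₂} : ℓ ∉ B → L.Step e₁ e₂ →
      ChorStep (.appLocalE ℓ e₁ e₂) B (.appLocal ℓ C e₁) (.appLocal ℓ C e₂)
  | appLocal {ℓ C v} : L.IsValue v →
      ChorStep (.appLocal ℓ v) ∅ (.appLocal ℓ (.funLocal ℓ C) v)
        ((C.localSubst ℓ (L.single v)).subst (Chor.single (.funLocal ℓ C)))
  | appGlobalFun {R B C₁ C₁' C₂} : ChorStep R B C₁ C₁' →
      ChorStep (.func R) B (.appGlobal C₁ C₂) (.appGlobal C₁' C₂)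
  | appGlobalArg {R B C₁ C₂ C₂'} : ChorStep R B C₂ C₂' →
      ChorStep (.arg R) B (.appGlobal C₁ C₂) (.appGlobal C₁ C₂')
  | appGlobal {C V} : V.IsValue →
      ChorStep .appGlobal ∅ (.appGlobal (.funGlobal C) V) (C.subst (Chor.double V (.funGlobal C)))

/-! ### The control language -/

/-- Control programs, with the same conventions for binders as for choreographies: `recv` and the
second component of `letRet` bind the local variable `0`; `funLocal E` binds the local variable `0`
(the argument) and the control variable `0` (the function itself); `funGlobal E` binds the control
variables `0` (the argument) and `1` (the function itself).  `allowL`, `allowR` and `allowLR` are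
the external choices that offer only the left branch, only the right branch, and both. -/
inductive Ctrl (Loc : Type u) (L : LocalLanguage.{v})
  | var (X : ℕ)
  | funLocal (E : Ctrl Loc L)
  | funGlobal (E : Ctrl Loc L)
  | appLocal (E : Ctrl Loc L) (e : L.Expr)
  | appGlobal (E₁ E₂ : Ctrl Loc L)
  | unit
  | ret (e : L.Expr)
  | letRet (E₁ E₂ : Ctrl Loc L)
  | send (e : L.Expr) (ℓ : Loc) (E : Ctrl Loc L)
  | recv (ℓ : Loc) (E : Ctrl Loc L)
  | ite (e : L.Expr) (E₁ E₂ : Ctrl Loc L)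
  | choose (d : SyncLabel) (ℓ : Loc) (E : Ctrl Loc L)
  | allowL (ℓ : Loc) (E : Ctrl Loc L)
  | allowR (ℓ : Loc) (E : Ctrl Loc L)
  | allowLR (ℓ : Loc) (E₁ E₂ : Ctrl Loc L)

namespace Ctrl

variable {Loc : Type u} {L : LocalLanguage.{v}}

/-- Every free control variable has index less than `n`, and every free local variable has index
less than `k`. -/
def ClosedBelow : Ctrl Loc L → ℕ → ℕ → Prop
  | var X, n, _ => X < n
  | funLocal E, n, k => E.ClosedBelow (n + 1) (k + 1)
  | funGlobal E, n, k => E.ClosedBelow (n + 2) k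
  | appLocal E e, n, k => E.ClosedBelow n k ∧ L.ClosedBelow k e
  | appGlobal E₁ E₂, n, k => E₁.ClosedBelow n k ∧ E₂.ClosedBelow n k
  | unit, _, _ => True
  | ret e, _, k => L.ClosedBelow k e
  | letRet E₁ E₂, n, k => E₁.ClosedBelow n k ∧ E₂.ClosedBelow n (k + 1)
  | send e _ E, n, k => L.ClosedBelow k e ∧ E.ClosedBelow n k
  | recv _ E, n, k => E.ClosedBelow n (k + 1)
  | ite e E₁ E₂, n, k => L.ClosedBelow k e ∧ E₁.ClosedBelow n k ∧ E₂.ClosedBelow n k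
  | choose _ _ E, n, k => E.ClosedBelow n k
  | allowL _ E, n, k => E.ClosedBelow n k
  | allowR _ E, n, k => E.ClosedBelow n k
  | allowLR _ E₁ E₂, n, k => E₁.ClosedBelow n k ∧ E₂.ClosedBelow n k

/-- A control program without free variables of either kind. -/
def Closed (E : Ctrl Loc L) : Prop := E.ClosedBelow 0 0

/-- Control values: the unit value, returned local values, and closed functions. -/
inductive IsValue : Ctrl Loc L → Prop
  | unit : IsValue unit
  | ret (v : L.Expr) : L.IsValue v → IsValue (ret v)
  | funLocal (E : Ctrl Loc L) : (funLocal E).Closed → IsValue (funLocal E)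
  | funGlobal (E : Ctrl Loc L) : (funGlobal E).Closed → IsValue (funGlobal E)

/-- Parallel substitution for local variables. -/
def localSubst : Ctrl Loc L → (ℕ → L.Expr) → Ctrl Loc L
  | var X, _ => var X
  | funLocal E, σ => funLocal (E.localSubst (L.up σ))
  | funGlobal E, σ => funGlobal (E.localSubst σ)
  | appLocal E e, σ => appLocal (E.localSubst σ) (L.subst e σ)
  | appGlobal E₁ E₂, σ => appGlobal (E₁.localSubst σ) (E₂.localSubst σ)
  | unit, _ => unit
  | ret e, σ => ret (L.subst e σ)
  | letRet E₁ E₂, σ => letRet (E₁.localSubst σ) (E₂.localSubst (L.up σ))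
  | send e ℓ E, σ => send (L.subst e σ) ℓ (E.localSubst σ)
  | recv ℓ E, σ => recv ℓ (E.localSubst (L.up σ))
  | ite e E₁ E₂, σ => ite (L.subst e σ) (E₁.localSubst σ) (E₂.localSubst σ)
  | choose d ℓ E, σ => choose d ℓ (E.localSubst σ)
  | allowL ℓ E, σ => allowL ℓ (E.localSubst σ)
  | allowR ℓ E, σ => allowR ℓ (E.localSubst σ)
  | allowLR ℓ E₁ E₂, σ => allowLR ℓ (E₁.localSubst σ) (E₂.localSubst σ)

/-- Renaming of control variables. -/
def rename : Ctrl Loc L → (ℕ → ℕ) → Ctrl Loc L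
  | var X, ξ => var (ξ X)
  | funLocal E, ξ => funLocal (E.rename (upRen ξ))
  | funGlobal E, ξ => funGlobal (E.rename (upRen (upRen ξ)))
  | appLocal E e, ξ => appLocal (E.rename ξ) e
  | appGlobal E₁ E₂, ξ => appGlobal (E₁.rename ξ) (E₂.rename ξ)
  | unit, _ => unit
  | ret e, _ => ret e
  | letRet E₁ E₂, ξ => letRet (E₁.rename ξ) (E₂.rename ξ)
  | send e ℓ E, ξ => send e ℓ (E.rename ξ)
  | recv ℓ E, ξ => recv ℓ (E.rename ξ)
  | ite e E₁ E₂, ξ => ite e (E₁.rename ξ) (E₂.rename ξ)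
  | choose d ℓ E, ξ => choose d ℓ (E.rename ξ)
  | allowL ℓ E, ξ => allowL ℓ (E.rename ξ)
  | allowR ℓ E, ξ => allowR ℓ (E.rename ξ)
  | allowLR ℓ E₁ E₂, ξ => allowLR ℓ (E₁.rename ξ) (E₂.rename ξ)

/-- A substitution for control variables moved under a binder for a control variable. -/
def up (σ : ℕ → Ctrl Loc L) : ℕ → Ctrl Loc L
  | 0 => var 0
  | n + 1 => (σ n).rename Nat.succ

/-- A substitution for control variables moved under a binder for a local variable. -/
def upLocal (σ : ℕ → Ctrl Loc L) : ℕ → Ctrl Loc L := fun n => (σ n).localSubst L.shift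

/-- Parallel, capture-avoiding substitution for control variables. -/
def subst : Ctrl Loc L → (ℕ → Ctrl Loc L) → Ctrl Loc L
  | var X, σ => σ X
  | funLocal E, σ => funLocal (E.subst (up (upLocal σ)))
  | funGlobal E, σ => funGlobal (E.subst (up (up σ)))
  | appLocal E e, σ => appLocal (E.subst σ) e
  | appGlobal E₁ E₂, σ => appGlobal (E₁.subst σ) (E₂.subst σ)
  | unit, _ => unit
  | ret e, _ => ret e
  | letRet E₁ E₂, σ => letRet (E₁.subst σ) (E₂.subst (upLocal σ))
  | send e ℓ E, σ => send e ℓ (E.subst σ)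
  | recv ℓ E, σ => recv ℓ (E.subst (upLocal σ))
  | ite e E₁ E₂, σ => ite e (E₁.subst σ) (E₂.subst σ)
  | choose d ℓ E, σ => choose d ℓ (E.subst σ)
  | allowL ℓ E, σ => allowL ℓ (E.subst σ)
  | allowR ℓ E, σ => allowR ℓ (E.subst σ)
  | allowLR ℓ E₁ E₂, σ => allowLR ℓ (E₁.subst σ) (E₂.subst σ)

/-- The substitution `[F ↦ D]` for the one control variable bound last. -/
def single (D : Ctrl Loc L) : ℕ → Ctrl Loc L
  | 0 => D
  | n + 1 => var n

/-- The substitution `[X ↦ V, F ↦ D]` for the two control variables bound last. -/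
def double (V D : Ctrl Loc L) : ℕ → Ctrl Loc L
  | 0 => V
  | 1 => D
  | n + 2 => var n

open scoped Classical in
/-- The partial merge operator; `none` means undefined. -/
noncomputable def merge : Ctrl Loc L → Ctrl Loc L → Option (Ctrl Loc L)
  | var X, var Y => if X = Y then some (var X) else none
  | unit, unit => some unit
  | ret e, ret e' => if e = e' then some (ret e) else none
  | ite e E₁₁ E₁₂, ite e' E₂₁ E₂₂ =>
      if e = e' then do
        let F₁ ← merge E₁₁ E₂₁
        let F₂ ← merge E₁₂ E₂₂
        return ite e F₁ F₂
      else none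
  | send e ℓ E₁, send e' ℓ' E₂ =>
      if e = e' ∧ ℓ = ℓ' then (merge E₁ E₂).map (send e ℓ) else none
  | recv ℓ E₁, recv ℓ' E₂ => if ℓ = ℓ' then (merge E₁ E₂).map (recv ℓ) else none
  | choose d ℓ E₁, choose d' ℓ' E₂ =>
      if d = d' ∧ ℓ = ℓ' then (merge E₁ E₂).map (choose d ℓ) else none
  | allowL ℓ E₁, allowL ℓ' E₂ => if ℓ = ℓ' then (merge E₁ E₂).map (allowL ℓ) else none
  | allowL ℓ E₁, allowR ℓ' E₂ => if ℓ = ℓ' then some (allowLR ℓ E₁ E₂) else none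
  | allowL ℓ E₁, allowLR ℓ' E₂₁ E₂₂ =>
      if ℓ = ℓ' then (merge E₁ E₂₁).map (fun F => allowLR ℓ F E₂₂) else none
  | allowR ℓ E₁, allowL ℓ' E₂ => if ℓ = ℓ' then some (allowLR ℓ E₂ E₁) else none
  | allowR ℓ E₁, allowR ℓ' E₂ => if ℓ = ℓ' then (merge E₁ E₂).map (allowR ℓ) else none
  | allowR ℓ E₁, allowLR ℓ' E₂₁ E₂₂ =>
      if ℓ = ℓ' then (merge E₁ E₂₂).map (fun F => allowLR ℓ E₂₁ F) else none
  | allowLR ℓ E₁₁ E₁₂, allowL ℓ' E₂ =>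
      if ℓ = ℓ' then (merge E₁₁ E₂).map (fun F => allowLR ℓ F E₁₂) else none
  | allowLR ℓ E₁₁ E₁₂, allowR ℓ' E₂ =>
      if ℓ = ℓ' then (merge E₁₂ E₂).map (fun F => allowLR ℓ E₁₁ F) else none
  | allowLR ℓ E₁₁ E₁₂, allowLR ℓ' E₂₁ E₂₂ =>
      if ℓ = ℓ' then do
        let F₁ ← merge E₁₁ E₂₁
        let F₂ ← merge E₁₂ E₂₂
        return allowLR ℓ F₁ F₂
      else none
  | letRet E₁₁ E₁₂, letRet E₂₁ E₂₂ => do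
      let F₁ ← merge E₁₁ E₂₁
      let F₂ ← merge E₁₂ E₂₂
      return letRet F₁ F₂
  | funLocal E, funLocal E' => if E = E' then some (funLocal E) else none
  | funGlobal E, funGlobal E' => if E = E' then some (funGlobal E) else none
  | appLocal E₁ e, appLocal E₂ e' =>
      if e = e' then (merge E₁ E₂).map (fun F => appLocal F e) else none
  | appGlobal E₁₁ E₁₂, appGlobal E₂₁ E₂₂ => do
      let F₁ ← merge E₁₁ E₂₁
      let F₂ ← merge E₁₂ E₂₂
      return appGlobal F₁ F₂
  | _, _ => none

end Ctrl

/-- Labels of steps of control programs. -/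
inductive Label (Loc : Type u) (L : LocalLanguage.{v})
  | iota
  | send (v : L.Expr) (ℓ : Loc)
  | recv (ℓ : Loc) (v : L.Expr)
  | choose (d : SyncLabel) (ℓ : Loc)
  | allow (ℓ : Loc) (d : SyncLabel)
  | syncIota
  | func (l : Label Loc L)
  | arg (l : Label Loc L)

/-- The labelled transition system of control programs. -/
inductive CtrlStep {Loc : Type u} {L : LocalLanguage.{v}} :
    Label Loc L → Ctrl Loc L → Ctrl Loc L → Prop
  | retE {e₁ e₂} : L.Step e₁ e₂ → CtrlStep .iota (.ret e₁) (.ret e₂)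
  | ifE {e₁ e₂ E₁ E₂} : L.Step e₁ e₂ → CtrlStep .iota (.ite e₁ E₁ E₂) (.ite e₂ E₁ E₂)
  | ifTrue {E₁ E₂} : CtrlStep .iota (.ite L.tt E₁ E₂) E₁
  | ifFalse {E₁ E₂} : CtrlStep .iota (.ite L.ff E₁ E₂) E₂
  | sendE {e₁ e₂ ℓ E} : L.Step e₁ e₂ → CtrlStep .iota (.send e₁ ℓ E) (.send e₂ ℓ E)
  | sendV {v ℓ E} : L.IsValue v → CtrlStep (.send v ℓ) (.send v ℓ E) E
  | recvV {v ℓ E} : L.IsValue v →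
      CtrlStep (.recv ℓ v) (.recv ℓ E) (E.localSubst (L.single v))
  | choose {d ℓ E} : CtrlStep (.choose d ℓ) (.choose d ℓ E) E
  | allowL {ℓ E} : CtrlStep (.allow ℓ .left) (.allowL ℓ E) E
  | allowR {ℓ E} : CtrlStep (.allow ℓ .right) (.allowR ℓ E) E
  | allowLRLeft {ℓ E₁ E₂} : CtrlStep (.allow ℓ .left) (.allowLR ℓ E₁ E₂) E₁
  | allowLRRight {ℓ E₁ E₂} : CtrlStep (.allow ℓ .right) (.allowLR ℓ E₁ E₂) E₂
  | letRetArg {l E₁ E₁' E₂} : CtrlStep l E₁ E₁' →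
      CtrlStep (.arg l) (.letRet E₁ E₂) (.letRet E₁' E₂)
  | letRet {v E₂} : L.IsValue v →
      CtrlStep .syncIota (.letRet (.ret v) E₂) (E₂.localSubst (L.single v))
  | appLocalFun {l E₁ E₂ e} : CtrlStep l E₁ E₂ →
      CtrlStep (.func l) (.appLocal E₁ e) (.appLocal E₂ e)
  | appLocalArg {E e₁ e₂} : L.Step e₁ e₂ → CtrlStep .iota (.appLocal E e₁) (.appLocal E e₂)
  | appLocal {E v} : L.IsValue v →
      CtrlStep .syncIota (.appLocal (.funLocal E) v)
        ((E.localSubst (L.single v)).subst (Ctrl.single (.funLocal E)))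
  | appGlobalFun {l E₁ E₂ A} : CtrlStep l E₁ E₂ →
      CtrlStep (.func l) (.appGlobal E₁ A) (.appGlobal E₂ A)
  | appGlobalArg {l F A₁ A₂} : CtrlStep l A₁ A₂ →
      CtrlStep (.arg l) (.appGlobal F A₁) (.appGlobal F A₂)
  | appGlobal {E V} : V.IsValue →
      CtrlStep .syncIota (.appGlobal (.funGlobal E) V) (E.subst (Ctrl.double V (.funGlobal E)))

/-- Labels of steps of systems. -/
inductive SysLabel (Loc : Type u) (L : LocalLanguage.{v})
  | iota
  | comm (ℓ₁ : Loc) (v : L.Expr) (ℓ₂ : Loc)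
  | choice (ℓ₁ : Loc) (d : SyncLabel) (ℓ₂ : Loc)
  | syncIota

/-- `LabelMerge l₁ l₂ S`: the control labels `l₁` and `l₂` match, and produce the system label
`S`. -/
inductive LabelMerge {Loc : Type u} {L : LocalLanguage.{v}} :
    Label Loc L → Label Loc L → SysLabel Loc L → Prop
  | iota : LabelMerge .iota .iota .iota
  | sync : LabelMerge .syncIota .syncIota .syncIota
  | comm {ℓ₁ v ℓ₂} : LabelMerge (.send v ℓ₂) (.recv ℓ₁ v) (.comm ℓ₁ v ℓ₂)
  | choice {ℓ₁ d ℓ₂} : LabelMerge (.choose d ℓ₂) (.allow ℓ₁ d) (.choice ℓ₁ d ℓ₂)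
  | func {l₁ l₂ S} : LabelMerge l₁ l₂ S → LabelMerge (.func l₁) (.func l₂) S
  | arg {l₁ l₂ S} : LabelMerge l₁ l₂ S → LabelMerge (.arg l₁) (.arg l₂) S

/-! ### Endpoint projection -/

open scoped Classical in
/-- Endpoint projection to the location `ℓ`; `none` means undefined.  The projection of a
`defLocal` or a `funLocal` of another location binds fresh control variables, for which the
control variables of the projected body are renamed: both variables of the function that a
`defLocal` produces are fresh, and the argument (but not the name) of the one that a `funLocal`
produces. -/
noncomputable def Chor.project {Loc : Type u} {L : LocalLanguage.{v}} :
    Chor Loc L → Loc → Option (Ctrl Loc L)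
  | .var X, _ => some (.var X)
  | .done ℓ' e, ℓ => if ℓ' = ℓ then some (.ret e) else some .unit
  | .send ℓ₁ e ℓ₂ C, ℓ =>
      if ℓ₁ = ℓ then
        if ℓ₂ = ℓ then none else (C.project ℓ).map (.send e ℓ₂)
      else
        if ℓ₂ = ℓ then (C.project ℓ).map (.recv ℓ₁) else C.project ℓ
  | .ite ℓ' e C₁ C₂, ℓ => do
      let E₁ ← C₁.project ℓ
      let E₂ ← C₂.project ℓ
      if ℓ' = ℓ then some (.ite e E₁ E₂) else E₁.merge E₂
  | .sync ℓ₁ d ℓ₂ C, ℓ =>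
      if ℓ₁ = ℓ then
        if ℓ₂ = ℓ then none else (C.project ℓ).map (.choose d ℓ₂)
      else
        if ℓ₂ = ℓ then
          match d with
          | .left => (C.project ℓ).map (.allowL ℓ₁)
          | .right => (C.project ℓ).map (.allowR ℓ₁)
        else C.project ℓ
  | .defLocal ℓ' C₁ C₂, ℓ => do
      let E₁ ← C₁.project ℓ
      let E₂ ← C₂.project ℓ
      if ℓ' = ℓ then some (.letRet E₁ E₂)
      else some (.appGlobal (.funGlobal (E₂.rename (fun n => n + 2))) E₁)
  | .funLocal ℓ' C, ℓ => do
      let E ← C.project ℓ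
      if ℓ' = ℓ then some (.funLocal E) else some (.funGlobal (E.rename (fun n => n + 1)))
  | .appLocal ℓ' C e, ℓ => do
      let E ← C.project ℓ
      if ℓ' = ℓ then some (.appLocal E e) else some (.appGlobal E .unit)
  | .funGlobal C, ℓ => (C.project ℓ).map .funGlobal
  | .appGlobal C₁ C₂, ℓ => do
      let E₁ ← C₁.project ℓ
      let E₂ ← C₂.project ℓ
      return .appGlobal E₁ E₂

open scoped Classical in
/-- The projection of a redex to a location's view of the step; `none` means undefined. -/
noncomputable def Redex.project {Loc : Type u} {L : LocalLanguage.{v}} :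
    Redex Loc L → Loc → Option (Label Loc L)
  | .done ℓ' _ _, ℓ => if ℓ' = ℓ then some .iota else none
  | .ifE ℓ' _ _, ℓ => if ℓ' = ℓ then some .iota else none
  | .ifT ℓ', ℓ => if ℓ' = ℓ then some .iota else none
  | .ifF ℓ', ℓ => if ℓ' = ℓ then some .iota else none
  | .appLocalE ℓ' _ _, ℓ => if ℓ' = ℓ then some .iota else none
  | .sendE ℓ' _ _ _, ℓ => if ℓ' = ℓ then some .iota else none
  | .sendV ℓ₁ v ℓ₂, ℓ =>
      if ℓ₁ = ℓ ∧ ℓ₂ ≠ ℓ then some (.send v ℓ₂)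
      else if ℓ₁ ≠ ℓ ∧ ℓ₂ = ℓ then some (.recv ℓ₁ v)
      else none
  | .sync ℓ₁ d ℓ₂, ℓ =>
      if ℓ₁ = ℓ ∧ ℓ₂ ≠ ℓ then some (.choose d ℓ₂)
      else if ℓ₁ ≠ ℓ ∧ ℓ₂ = ℓ then some (.allow ℓ₁ d)
      else none
  | .defLocal _ _, _ => some .syncIota
  | .appLocal _ _, _ => some .syncIota
  | .appGlobal, _ => some .syncIota
  | .arg R, ℓ => (R.project ℓ).map .arg
  | .func R, ℓ => (R.project ℓ).map .func

end Pirouette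

namespace Pirouette

variable {Loc : Type u} {L : LocalLanguage.{v}}

/-! ### Substitution in control programs -/

namespace Ctrl

/-! A projection to `ℓ` skips the prefixes and conditionals in which `ℓ` takes no part, and the
choreography must reach the redex past them. The out-of-order rules allow exactly this: what `ℓ`
skips blocks only locations other than `ℓ`. Steps are therefore lifted by induction on the
derivation of the projection, with the invariant that the acting locations are not blocked.

The obstacle is an `if` at another location. Its projection is a merge, and both branches of the
choreography must step with the same redex. The label `iota` is too coarse for this, so `RedexStep`
annotates control steps with redices, and `Ctrl.Merges.redexStep` splits a step of a merge into two
steps with one redex. The splitting fails only for an external choice whose selected branch comes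
from one side alone. This cannot concern local steps (`Projects.exists_chorStep_of_isLocal`). In a
choice between two locations the sender takes the same step in both branches, so where the receiver
offers only the opposite label the two views of one synchronization would disagree;
`Projects.not_redexStep_flip` excludes this, and `Projects.exists_chorStep_of_isBetween` follows.

For β-steps all locations of `𝔏` move at once. A send, synchronization or `if` at the head is
impossible, because its acting location lies in `𝔏` and its projection has no β-step there. Hence
neither blocking nor merging arises, and the `Fun`/`Arg` path of the label leads straight to a `let`
or an application. That its parts are functions and values is recovered from all projections
together (`Chor.cases_of_projects_isIntro`, `Chor.isValue_of_projects`). The results match because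
projection commutes with substitution (`Projects.localSubst`, `Projects.localSubst_ne`,
`Projects.subst`). -/

theorem rename_rename (E : Ctrl Loc L) (ξ ζ : ℕ → ℕ) :
    (E.rename ξ).rename ζ = E.rename (fun n => ζ (ξ n)) := by
  have up_comp (ξ ζ : ℕ → ℕ) :
      (fun n => upRen ζ (upRen ξ n)) = upRen (fun n => ζ (ξ n)) := by
    funext n; cases n <;> rfl
  induction E generalizing ξ ζ <;> simp_all [rename]

theorem localSubst_rename (E : Ctrl Loc L) (ξ : ℕ → ℕ) (σ : ℕ → L.Expr) :
    (E.rename ξ).localSubst σ = (E.localSubst σ).rename ξ := by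
  induction E generalizing ξ σ <;> simp_all [rename, localSubst]

theorem up_comp_upRen (τ : ℕ → Ctrl Loc L) (ξ : ℕ → ℕ) :
    (fun n => up τ (upRen ξ n)) = up (fun n => τ (ξ n)) := by
  funext n; cases n <;> rfl

/-- Projection renames bodies to make room for fresh binders, so β-steps of projected programs
substitute into renamed bodies. Here the renaming is absorbed by the substitution. -/
theorem subst_rename (E : Ctrl Loc L) (ξ : ℕ → ℕ) (τ : ℕ → Ctrl Loc L) :
    (E.rename ξ).subst τ = E.subst (fun n => τ (ξ n)) := by
  have upLocal_comp (τ : ℕ → Ctrl Loc L) (ξ : ℕ → ℕ) :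
      (fun n => upLocal τ (ξ n)) = upLocal (fun n => τ (ξ n)) := rfl
  induction E generalizing ξ τ <;> simp_all [rename, subst, up_comp_upRen]

theorem rename_up (τ : ℕ → Ctrl Loc L) (ξ : ℕ → ℕ) :
    (fun n => (up τ n).rename (upRen ξ)) = up (fun n => (τ n).rename ξ) := by
  funext n
  cases n with
  | zero => rfl
  | succ n => simp [up, rename_rename, upRen]

theorem rename_upLocal (τ : ℕ → Ctrl Loc L) (ξ : ℕ → ℕ) :
    (fun n => (upLocal τ n).rename ξ) = upLocal (fun n => (τ n).rename ξ) := by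
  funext n
  simp [upLocal, localSubst_rename]

theorem rename_subst (E : Ctrl Loc L) (τ : ℕ → Ctrl Loc L) (ξ : ℕ → ℕ) :
    (E.subst τ).rename ξ = E.subst (fun n => (τ n).rename ξ) := by
  induction E generalizing ξ τ <;> simp_all [rename, subst, rename_up, rename_upLocal]

theorem up_var : up (var : ℕ → Ctrl Loc L) = var := by
  funext n; cases n <;> rfl

theorem subst_var (E : Ctrl Loc L) : E.subst var = E := by
  have upLocal_var : upLocal (var : ℕ → Ctrl Loc L) = var := rfl
  induction E <;> simp_all [subst, up_var]

/-- Carries closedness back through the renamings that projection inserts. Only indices that `ξ`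
sends below `m` can occur freely, so nothing is asked of the others. -/
theorem ClosedBelow.of_rename {E : Ctrl Loc L} {ξ : ℕ → ℕ} {m n k : ℕ}
    (h : (E.rename ξ).ClosedBelow m k) (hξ : ∀ i, ξ i < m → i < n) : E.ClosedBelow n k := by
  have up_lt {ξ : ℕ → ℕ} {m n : ℕ} (hξ : ∀ i, ξ i < m → i < n) :
      ∀ i, upRen ξ i < m + 1 → i < n + 1 := by
    rintro (_ | i) hi
    · omega
    · have := hξ i (by simpa [upRen] using hi)
      omega
  induction E generalizing ξ m n k with
  | var X => exact hξ X h
  | funLocal E ih => exact ih h (up_lt hξ)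
  | funGlobal E ih => exact ih h (up_lt (up_lt hξ))
  | appLocal E e ih => exact ⟨ih h.1 hξ, h.2⟩
  | appGlobal E₁ E₂ ih₁ ih₂ => exact ⟨ih₁ h.1 hξ, ih₂ h.2 hξ⟩
  | unit => trivial
  | ret e => exact h
  | letRet E₁ E₂ ih₁ ih₂ => exact ⟨ih₁ h.1 hξ, ih₂ h.2 hξ⟩
  | send e ℓ E ih => exact ⟨h.1, ih h.2 hξ⟩
  | recv ℓ E ih => exact ih h hξ
  | ite e E₁ E₂ ih₁ ih₂ => exact ⟨h.1, ih₁ h.2.1 hξ, ih₂ h.2.2 hξ⟩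
  | choose d ℓ E ih => exact ih h hξ
  | allowL ℓ E ih => exact ih h hξ
  | allowR ℓ E ih => exact ih h hξ
  | allowLR ℓ E₁ E₂ ih₁ ih₂ => exact ⟨ih₁ h.1 hξ, ih₂ h.2 hξ⟩

/-! ### Merging as a relation -/

/-- `Merges A B E` says that `A` and `B` merge to `E`. -/
inductive Merges : Ctrl Loc L → Ctrl Loc L → Ctrl Loc L → Prop
  | var {X} : Merges (var X) (var X) (var X)
  | unit : Merges unit unit unit
  | ret {e} : Merges (ret e) (ret e) (ret e)
  | ite {e A₁ A₂ B₁ B₂ E₁ E₂} : Merges A₁ B₁ E₁ → Merges A₂ B₂ E₂ →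
      Merges (ite e A₁ A₂) (ite e B₁ B₂) (ite e E₁ E₂)
  | send {e ℓ A B E} : Merges A B E → Merges (send e ℓ A) (send e ℓ B) (send e ℓ E)
  | recv {ℓ A B E} : Merges A B E → Merges (recv ℓ A) (recv ℓ B) (recv ℓ E)
  | choose {d ℓ A B E} : Merges A B E → Merges (choose d ℓ A) (choose d ℓ B) (choose d ℓ E)
  | allowLL {ℓ A B E} : Merges A B E → Merges (allowL ℓ A) (allowL ℓ B) (allowL ℓ E)
  | allowL_R {ℓ A B} : Merges (allowL ℓ A) (allowR ℓ B) (allowLR ℓ A B)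
  | allowL_LR {ℓ A B₁ B₂ E} : Merges A B₁ E →
      Merges (allowL ℓ A) (allowLR ℓ B₁ B₂) (allowLR ℓ E B₂)
  | allowR_L {ℓ A B} : Merges (allowR ℓ A) (allowL ℓ B) (allowLR ℓ B A)
  | allowRR {ℓ A B E} : Merges A B E → Merges (allowR ℓ A) (allowR ℓ B) (allowR ℓ E)
  | allowR_LR {ℓ A B₁ B₂ E} : Merges A B₂ E →
      Merges (allowR ℓ A) (allowLR ℓ B₁ B₂) (allowLR ℓ B₁ E)
  | allowLR_L {ℓ A₁ A₂ B E} : Merges A₁ B E →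
      Merges (allowLR ℓ A₁ A₂) (allowL ℓ B) (allowLR ℓ E A₂)
  | allowLR_R {ℓ A₁ A₂ B E} : Merges A₂ B E →
      Merges (allowLR ℓ A₁ A₂) (allowR ℓ B) (allowLR ℓ A₁ E)
  | allowLR {ℓ A₁ A₂ B₁ B₂ E₁ E₂} : Merges A₁ B₁ E₁ → Merges A₂ B₂ E₂ →
      Merges (allowLR ℓ A₁ A₂) (allowLR ℓ B₁ B₂) (allowLR ℓ E₁ E₂)
  | letRet {A₁ A₂ B₁ B₂ E₁ E₂} : Merges A₁ B₁ E₁ → Merges A₂ B₂ E₂ →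
      Merges (letRet A₁ A₂) (letRet B₁ B₂) (letRet E₁ E₂)
  | funLocal {A} : Merges (funLocal A) (funLocal A) (funLocal A)
  | funGlobal {A} : Merges (funGlobal A) (funGlobal A) (funGlobal A)
  | appLocal {A B E e} : Merges A B E →
      Merges (appLocal A e) (appLocal B e) (appLocal E e)
  | appGlobal {A₁ A₂ B₁ B₂ E₁ E₂} : Merges A₁ B₁ E₁ → Merges A₂ B₂ E₂ →
      Merges (appGlobal A₁ A₂) (appGlobal B₁ B₂) (appGlobal E₁ E₂)

theorem merge_eq_some_iff {A B E : Ctrl Loc L} : A.merge B = some E ↔ Merges A B E := by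
  constructor
  · intro h
    induction A generalizing B E <;> cases B <;>
      simp only [merge, reduceCtorEq, Option.ite_none_right_eq_some, Option.bind_eq_bind,
        Option.bind_eq_some_iff, Option.map_eq_some_iff, Option.pure_def, Option.some.injEq] at h <;>
      grind [Merges]
  · intro h
    induction h <;> simp_all [merge]

theorem Merges.refl (A : Ctrl Loc L) : Merges A A A := by
  induction A <;> constructor <;> assumption

theorem Merges.rename {A B E : Ctrl Loc L} (h : Merges A B E) (ξ : ℕ → ℕ) :
    Merges (A.rename ξ) (B.rename ξ) (E.rename ξ) := by
  induction h <;> constructor <;> assumption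

theorem Merges.localSubst {A B E : Ctrl Loc L} (h : Merges A B E) (σ : ℕ → L.Expr) :
    Merges (A.localSubst σ) (B.localSubst σ) (E.localSubst σ) := by
  induction h generalizing σ <;> constructor <;> apply_assumption

theorem Merges.subst {A B E : Ctrl Loc L} (h : Merges A B E) (τ : ℕ → Ctrl Loc L) :
    Merges (A.subst τ) (B.subst τ) (E.subst τ) := by
  induction h generalizing τ with
  -- The variable becomes an arbitrary program, which must merge with itself.
  | var => exact Merges.refl _
  | _ => constructor <;> apply_assumption

/-- Merging discards nothing: every variable of either program survives in the result. -/
theorem Merges.closedBelow {A B E : Ctrl Loc L} (h : Merges A B E) {n k : ℕ}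
    (hE : E.ClosedBelow n k) : A.ClosedBelow n k ∧ B.ClosedBelow n k := by
  induction h generalizing n k <;> simp only [ClosedBelow] at hE ⊢ <;> grind

end Ctrl

/-! ### Projection as a relation -/

/-- `Projects ℓ C E` says that the projection of `C` to `ℓ` is `E`. -/
inductive Projects (ℓ : Loc) : Chor Loc L → Ctrl Loc L → Prop
  | var {X} : Projects ℓ (.var X) (.var X)
  | done {e} : Projects ℓ (.done ℓ e) (.ret e)
  | done_ne {ℓ' e} : ℓ' ≠ ℓ → Projects ℓ (.done ℓ' e) .unit
  | send {ℓ₂ e C E} : ℓ ≠ ℓ₂ → Projects ℓ C E → Projects ℓ (.send ℓ e ℓ₂ C) (.send e ℓ₂ E)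
  | recv {ℓ₁ e C E} : ℓ₁ ≠ ℓ → Projects ℓ C E → Projects ℓ (.send ℓ₁ e ℓ C) (.recv ℓ₁ E)
  | send_ne {ℓ₁ e ℓ₂ C E} : ℓ₁ ≠ ℓ → ℓ₂ ≠ ℓ → Projects ℓ C E → Projects ℓ (.send ℓ₁ e ℓ₂ C) E
  | ite {e C₁ C₂ E₁ E₂} : Projects ℓ C₁ E₁ → Projects ℓ C₂ E₂ →
      Projects ℓ (.ite ℓ e C₁ C₂) (.ite e E₁ E₂)
  | ite_ne {ℓ' e C₁ C₂ E₁ E₂ E} : ℓ' ≠ ℓ → Projects ℓ C₁ E₁ → Projects ℓ C₂ E₂ →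
      Ctrl.Merges E₁ E₂ E → Projects ℓ (.ite ℓ' e C₁ C₂) E
  | choose {d ℓ₂ C E} : ℓ ≠ ℓ₂ → Projects ℓ C E →
      Projects ℓ (.sync ℓ d ℓ₂ C) (.choose d ℓ₂ E)
  | allowL {ℓ₁ C E} : ℓ₁ ≠ ℓ → Projects ℓ C E → Projects ℓ (.sync ℓ₁ .left ℓ C) (.allowL ℓ₁ E)
  | allowR {ℓ₁ C E} : ℓ₁ ≠ ℓ → Projects ℓ C E → Projects ℓ (.sync ℓ₁ .right ℓ C) (.allowR ℓ₁ E)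
  | sync_ne {ℓ₁ d ℓ₂ C E} : ℓ₁ ≠ ℓ → ℓ₂ ≠ ℓ → Projects ℓ C E → Projects ℓ (.sync ℓ₁ d ℓ₂ C) E
  | defLocal {C₁ C₂ E₁ E₂} : Projects ℓ C₁ E₁ → Projects ℓ C₂ E₂ →
      Projects ℓ (.defLocal ℓ C₁ C₂) (.letRet E₁ E₂)
  | defLocal_ne {ℓ' C₁ C₂ E₁ E₂} : ℓ' ≠ ℓ → Projects ℓ C₁ E₁ → Projects ℓ C₂ E₂ →
      Projects ℓ (.defLocal ℓ' C₁ C₂) (.appGlobal (.funGlobal (E₂.rename (fun n => n + 2))) E₁)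
  | funLocal {C E} : Projects ℓ C E → Projects ℓ (.funLocal ℓ C) (.funLocal E)
  | funLocal_ne {ℓ' C E} : ℓ' ≠ ℓ → Projects ℓ C E →
      Projects ℓ (.funLocal ℓ' C) (.funGlobal (E.rename (fun n => n + 1)))
  | appLocal {C E e} : Projects ℓ C E → Projects ℓ (.appLocal ℓ C e) (.appLocal E e)
  | appLocal_ne {ℓ' C E e} : ℓ' ≠ ℓ → Projects ℓ C E →
      Projects ℓ (.appLocal ℓ' C e) (.appGlobal E .unit)
  | funGlobal {C E} : Projects ℓ C E → Projects ℓ (.funGlobal C) (.funGlobal E)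
  | appGlobal {C₁ C₂ E₁ E₂} : Projects ℓ C₁ E₁ → Projects ℓ C₂ E₂ →
      Projects ℓ (.appGlobal C₁ C₂) (.appGlobal E₁ E₂)

theorem project_eq_some_iff {C : Chor Loc L} {ℓ : Loc} {E : Ctrl Loc L} :
    C.project ℓ = some E ↔ Projects ℓ C E := by
  constructor
  · intro h
    induction C generalizing E with
    | sync ℓ₁ d ℓ₂ C ih =>
      cases d <;> simp only [Chor.project] at h <;> split_ifs at h <;>
        try simp only [Option.map_eq_some_iff] at h
      all_goals grind [Projects]
    | _ =>
      simp only [Chor.project, Option.bind_eq_bind, Option.pure_def] at h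
      try split_ifs at h
      all_goals
        try simp only [Option.bind_eq_some_iff, Option.map_eq_some_iff, Option.some.injEq,
          Ctrl.merge_eq_some_iff] at h
      all_goals grind [Projects]
  · intro h
    induction h with
    | send h => simp_all [Chor.project, h.symm]
    | choose h => simp_all [Chor.project, h.symm]
    | _ => simp_all [Chor.project, Ctrl.merge_eq_some_iff]

/-! ### Projection commutes with renaming and substitution. -/

namespace Projects

variable {ℓ : Loc} {C : Chor Loc L} {E : Ctrl Loc L}

theorem rename (h : Projects ℓ C E) (ξ : ℕ → ℕ) : Projects ℓ (C.rename ξ) (E.rename ξ) := by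
  induction h generalizing ξ with
  | ite_ne hn _ _ hm ih₁ ih₂ => exact .ite_ne hn (ih₁ ξ) (ih₂ ξ) (hm.rename ξ)
  | defLocal_ne hn _ _ ih₁ ih₂ =>
    have := Projects.defLocal_ne hn (ih₁ ξ) (ih₂ ξ)
    simpa [Chor.rename, Ctrl.rename, Ctrl.rename_rename, upRen] using this
  | funLocal_ne hn _ ih =>
    have := Projects.funLocal_ne hn (ih (upRen ξ))
    simpa [Chor.rename, Ctrl.rename, Ctrl.rename_rename, upRen] using this
  | _ => constructor <;> apply_assumption

/-- Only expressions of `ℓ'` change, and the projection to `ℓ` keeps none of them. -/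
theorem localSubst_ne {ℓ' : Loc} (hne : ℓ' ≠ ℓ) (h : Projects ℓ C E) (σ : ℕ → L.Expr) :
    Projects ℓ (C.localSubst ℓ' σ) E := by
  induction h generalizing σ with
  | ite_ne hn _ _ hm ih₁ ih₂ => exact .ite_ne hn (ih₁ σ) (ih₂ σ) hm
  | _ =>
    simp only [Chor.localSubst, Chor.exprSubstAt, Chor.upAt, if_neg hne]
    constructor <;> apply_assumption

theorem localSubst (h : Projects ℓ C E) (σ : ℕ → L.Expr) :
    Projects ℓ (C.localSubst ℓ σ) (E.localSubst σ) := by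
  induction h generalizing σ with
  | ite_ne hn _ _ hm ih₁ ih₂ => exact .ite_ne hn (ih₁ σ) (ih₂ σ) (hm.localSubst σ)
  | send_ne h₁ h₂ _ ih =>
    rw [Chor.localSubst, Chor.upAt, if_neg h₂.symm]
    exact .send_ne h₁ h₂ (ih σ)
  | send h₂ _ ih =>
    simp only [Chor.localSubst, Chor.exprSubstAt, Chor.upAt, if_neg h₂, if_true]
    exact .send h₂ (ih σ)
  | defLocal_ne hn _ _ ih₁ ih₂ =>
    simp only [Chor.localSubst, Chor.upAt, if_neg hn.symm, Ctrl.localSubst,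
      Ctrl.localSubst_rename]
    exact .defLocal_ne hn (ih₁ σ) (ih₂ σ)
  | funLocal_ne hn _ ih =>
    simp only [Chor.localSubst, Chor.upAt, if_neg hn.symm, Ctrl.localSubst,
      Ctrl.localSubst_rename]
    exact .funLocal_ne hn (ih σ)
  | _ =>
    simp only [Chor.localSubst, Chor.exprSubstAt, Chor.upAt, if_true]
    constructor <;> apply_assumption

theorem up {σ : ℕ → Chor Loc L} {τ : ℕ → Ctrl Loc L} (h : ∀ n, Projects ℓ (σ n) (τ n)) (n : ℕ) :
    Projects ℓ (Chor.up σ n) (Ctrl.up τ n) := by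
  cases n with
  | zero => exact .var
  | succ n => exact (h n).rename _

theorem upLocal {σ : ℕ → Chor Loc L} {τ : ℕ → Ctrl Loc L} (h : ∀ n, Projects ℓ (σ n) (τ n))
    (n : ℕ) : Projects ℓ (Chor.upLocal ℓ σ n) (Ctrl.upLocal τ n) :=
  (h n).localSubst _

theorem upLocal_ne {ℓ' : Loc} (hne : ℓ' ≠ ℓ) {σ : ℕ → Chor Loc L} {τ : ℕ → Ctrl Loc L}
    (h : ∀ n, Projects ℓ (σ n) (τ n)) (n : ℕ) : Projects ℓ (Chor.upLocal ℓ' σ n) (τ n) :=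
  (h n).localSubst_ne hne _

/-- Under a binder for a local variable the substituted choreographies are weakened only in the
namespace of the binding location. The control substitution is thus lifted when that location is `ℓ`
and stays as it is otherwise (`upLocal`, `upLocal_ne`). -/
theorem subst (h : Projects ℓ C E) {σ : ℕ → Chor Loc L} {τ : ℕ → Ctrl Loc L}
    (hσ : ∀ n, Projects ℓ (σ n) (τ n)) : Projects ℓ (C.subst σ) (E.subst τ) := by
  induction h generalizing σ τ with
  | var => exact hσ _
  | done => exact .done
  | done_ne hn => exact .done_ne hn
  | send h₂ _ ih => exact .send h₂ (ih (upLocal_ne h₂.symm hσ))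
  | recv h₁ _ ih => exact .recv h₁ (ih (upLocal hσ))
  | send_ne h₁ h₂ _ ih => exact .send_ne h₁ h₂ (ih (upLocal_ne h₂ hσ))
  | ite_ne hn _ _ hm ih₁ ih₂ => exact .ite_ne hn (ih₁ hσ) (ih₂ hσ) (hm.subst τ)
  | defLocal _ _ ih₁ ih₂ => exact .defLocal (ih₁ hσ) (ih₂ (upLocal hσ))
  | defLocal_ne hn _ _ ih₁ ih₂ =>
    have := Projects.defLocal_ne hn (ih₁ hσ) (ih₂ (upLocal_ne hn hσ))
    simpa [Chor.subst, Ctrl.subst, Ctrl.rename_subst, Ctrl.subst_rename, Ctrl.up,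
      Ctrl.rename_rename] using this
  | funLocal _ ih => exact .funLocal (ih (up (upLocal hσ)))
  | funLocal_ne hn _ ih =>
    have := Projects.funLocal_ne hn (ih (up (upLocal_ne hn hσ)))
    simpa [Chor.subst, Ctrl.subst, Ctrl.rename_subst, Ctrl.subst_rename, Ctrl.up] using this
  | funGlobal _ ih => exact .funGlobal (ih (up (up hσ)))
  | _ => constructor <;> apply_assumption <;> assumption

end Projects

/-! ### Steps of control programs annotated with redices -/

/-- The other synchronization label. -/
def SyncLabel.flip : SyncLabel → SyncLabel
  | left => right
  | right => left

namespace Redex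

/-- Redices of steps that involve a single location. -/
def IsLocal : Redex Loc L → Prop
  | done _ _ _ | ifE _ _ _ | ifT _ | ifF _ | sendE _ _ _ _ | appLocalE _ _ _ => True
  | arg R | func R => R.IsLocal
  | _ => False

/-- Redices of synchronizations from `ℓ₁` to `ℓ₂`. -/
def IsSync (ℓ₁ ℓ₂ : Loc) : Redex Loc L → Prop
  | sync a _ b => a = ℓ₁ ∧ b = ℓ₂
  | arg R | func R => R.IsSync ℓ₁ ℓ₂
  | _ => False

/-- Redices of communications and synchronizations from `ℓ₁` to `ℓ₂`. -/
def IsBetween (ℓ₁ ℓ₂ : Loc) : Redex Loc L → Prop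
  | sendV a _ b | sync a _ b => a = ℓ₁ ∧ b = ℓ₂
  | arg R | func R => R.IsBetween ℓ₁ ℓ₂
  | _ => False

/-- The redex with the opposite synchronization label. -/
def flip : Redex Loc L → Redex Loc L
  | sync a d b => sync a d.flip b
  | arg R => arg R.flip
  | func R => func R.flip
  | R => R

theorem IsSync.not_isLocal {ℓ₁ ℓ₂ : Loc} {R : Redex Loc L} (h : R.IsSync ℓ₁ ℓ₂) :
    ¬ R.IsLocal := by
  induction R <;> simp_all [IsSync, IsLocal]

theorem IsSync.eq_of_isBetween {a b ℓ₁ ℓ₂ : Loc} {R : Redex Loc L} (h : R.IsSync a b)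
    (h' : R.IsBetween ℓ₁ ℓ₂) : a = ℓ₁ ∧ b = ℓ₂ := by
  induction R <;> simp_all [IsSync, IsBetween]

theorem IsSync.isBetween {ℓ₁ ℓ₂ : Loc} {R : Redex Loc L} (h : R.IsSync ℓ₁ ℓ₂) :
    R.IsBetween ℓ₁ ℓ₂ := by
  induction R <;> simp_all [IsSync, IsBetween]

theorem IsSync.flip {ℓ₁ ℓ₂ : Loc} {R : Redex Loc L} (h : R.IsSync ℓ₁ ℓ₂) :
    R.flip.IsSync ℓ₁ ℓ₂ := by
  induction R <;> simp_all [IsSync, Redex.flip]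

end Redex

/-- `RedexStep ℓ R E E'` says that the program `E` of `ℓ` takes the step to `E'` which is the view
of `ℓ` on a choreography step with redex `R`, other than a `β`-step. -/
inductive RedexStep (ℓ : Loc) : Redex Loc L → Ctrl Loc L → Ctrl Loc L → Prop
  | retE {e₁ e₂} : L.Step e₁ e₂ → RedexStep ℓ (.done ℓ e₁ e₂) (.ret e₁) (.ret e₂)
  | ifE {e₁ e₂ E₁ E₂} : L.Step e₁ e₂ →
      RedexStep ℓ (.ifE ℓ e₁ e₂) (.ite e₁ E₁ E₂) (.ite e₂ E₁ E₂)
  | ifTrue {E₁ E₂} : RedexStep ℓ (.ifT ℓ) (.ite L.tt E₁ E₂) E₁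
  | ifFalse {E₁ E₂} : RedexStep ℓ (.ifF ℓ) (.ite L.ff E₁ E₂) E₂
  | sendE {e₁ e₂ ℓ₂ E} : L.Step e₁ e₂ →
      RedexStep ℓ (.sendE ℓ e₁ e₂ ℓ₂) (.send e₁ ℓ₂ E) (.send e₂ ℓ₂ E)
  | sendV {v ℓ₂ E} : L.IsValue v → RedexStep ℓ (.sendV ℓ v ℓ₂) (.send v ℓ₂ E) E
  | recvV {v ℓ₁ E} : L.IsValue v →
      RedexStep ℓ (.sendV ℓ₁ v ℓ) (.recv ℓ₁ E) (E.localSubst (L.single v))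
  | choose {d ℓ₂ E} : RedexStep ℓ (.sync ℓ d ℓ₂) (.choose d ℓ₂ E) E
  | allowL {ℓ₁ E} : RedexStep ℓ (.sync ℓ₁ .left ℓ) (.allowL ℓ₁ E) E
  | allowR {ℓ₁ E} : RedexStep ℓ (.sync ℓ₁ .right ℓ) (.allowR ℓ₁ E) E
  | allowLRLeft {ℓ₁ E₁ E₂} : RedexStep ℓ (.sync ℓ₁ .left ℓ) (.allowLR ℓ₁ E₁ E₂) E₁
  | allowLRRight {ℓ₁ E₁ E₂} : RedexStep ℓ (.sync ℓ₁ .right ℓ) (.allowLR ℓ₁ E₁ E₂) E₂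
  | letRetArg {R E₁ E₁' E₂} : RedexStep ℓ R E₁ E₁' →
      RedexStep ℓ (.arg R) (.letRet E₁ E₂) (.letRet E₁' E₂)
  | appLocalFun {R E₁ E₂ e} : RedexStep ℓ R E₁ E₂ →
      RedexStep ℓ (.func R) (.appLocal E₁ e) (.appLocal E₂ e)
  | appLocalArg {E e₁ e₂} : L.Step e₁ e₂ →
      RedexStep ℓ (.appLocalE ℓ e₁ e₂) (.appLocal E e₁) (.appLocal E e₂)
  | appGlobalFun {R E₁ E₂ A} : RedexStep ℓ R E₁ E₂ →
      RedexStep ℓ (.func R) (.appGlobal E₁ A) (.appGlobal E₂ A)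
  | appGlobalArg {R F A₁ A₂} : RedexStep ℓ R A₁ A₂ →
      RedexStep ℓ (.arg R) (.appGlobal F A₁) (.appGlobal F A₂)

/-- The label `iota` forgets which expression moved and in which construct; the redex restores this,
so that both branches of a skipped `if` can be required to make the same move. -/
theorem CtrlStep.redexStep_of_iota {l : Label Loc L} {E E' : Ctrl Loc L} (ℓ : Loc)
    (h : CtrlStep l E E') (hl : LabelMerge l l .iota) :
    ∃ R : Redex Loc L, RedexStep ℓ R E E' ∧ R.IsLocal ∧ R.project ℓ = some l := by
  induction h with
  | retE h => exact ⟨_, .retE h, trivial, if_pos rfl⟩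
  | ifE h => exact ⟨_, .ifE h, trivial, if_pos rfl⟩
  | ifTrue => exact ⟨_, .ifTrue, trivial, if_pos rfl⟩
  | ifFalse => exact ⟨_, .ifFalse, trivial, if_pos rfl⟩
  | sendE h => exact ⟨_, .sendE h, trivial, if_pos rfl⟩
  | appLocalArg h => exact ⟨_, .appLocalArg h, trivial, if_pos rfl⟩
  | letRetArg _ ih =>
    cases hl with | arg hl =>
    obtain ⟨R, h₂, h₁, h₃⟩ := ih hl
    exact ⟨.arg R, .letRetArg h₂, h₁, by simp [Redex.project, h₃]⟩
  | appLocalFun _ ih =>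
    cases hl with | func hl =>
    obtain ⟨R, h₂, h₁, h₃⟩ := ih hl
    exact ⟨.func R, .appLocalFun h₂, h₁, by simp [Redex.project, h₃]⟩
  | appGlobalFun _ ih =>
    cases hl with | func hl =>
    obtain ⟨R, h₂, h₁, h₃⟩ := ih hl
    exact ⟨.func R, .appGlobalFun h₂, h₁, by simp [Redex.project, h₃]⟩
  | appGlobalArg _ ih =>
    cases hl with | arg hl =>
    obtain ⟨R, h₂, h₁, h₃⟩ := ih hl
    exact ⟨.arg R, .appGlobalArg h₂, h₁, by simp [Redex.project, h₃]⟩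
  | _ => cases hl

/-- The system labels of communications and of choices. -/
def SysLabel.IsBetween (ℓ₁ ℓ₂ : Loc) : SysLabel Loc L → Prop
  | comm a _ b | choice a _ b => a = ℓ₁ ∧ b = ℓ₂
  | _ => False

/-- Each label knows only the partner, but the two matched labels together determine one redex. The
two programs may use different kinds of application or binding along the common `Fun`/`Arg` path,
since a construct local to one location projects to a global application at the others. Distinctness
is needed only to project the redex back. -/
theorem LabelMerge.exists_redexStep {l₁ l₂ : Label Loc L} {S : SysLabel Loc L} {ℓ₁ ℓ₂ : Loc}
    (hl : LabelMerge l₁ l₂ S) (hS : S.IsBetween ℓ₁ ℓ₂) {P₁ P₂ E₁ E₂ : Ctrl Loc L}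
    (h₁ : CtrlStep l₁ P₁ E₁) (h₂ : CtrlStep l₂ P₂ E₂) :
    ∃ R : Redex Loc L, R.IsBetween ℓ₁ ℓ₂ ∧ RedexStep ℓ₁ R P₁ E₁ ∧ RedexStep ℓ₂ R P₂ E₂ ∧
      (ℓ₁ ≠ ℓ₂ → R.project ℓ₁ = some l₁ ∧ R.project ℓ₂ = some l₂) := by
  induction hl generalizing P₁ P₂ E₁ E₂ with
  | iota => exact hS.elim
  | sync => exact hS.elim
  | @comm a v b =>
    obtain ⟨rfl, rfl⟩ := hS
    refine ⟨.sendV a v b, ⟨rfl, rfl⟩, ?_, ?_, fun hne => ?_⟩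
    · cases h₁ with | sendV hv => exact .sendV hv
    · cases h₂ with | recvV hv => exact .recvV hv
    · simp [Redex.project, hne, hne.symm]
  | @choice a d b =>
    obtain ⟨rfl, rfl⟩ := hS
    refine ⟨.sync a d b, ⟨rfl, rfl⟩, ?_, ?_, fun hne => ?_⟩
    · cases h₁; exact .choose
    · cases h₂ <;> constructor
    · simp [Redex.project, hne, hne.symm]
  | func _ ih =>
    have main {A A' B B' : Ctrl Loc L} (hA : CtrlStep _ A A') (hB : CtrlStep _ B B') :=
      ih hS hA hB
    cases h₁ with
    | appLocalFun s₁ =>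
      cases h₂ with
      | appLocalFun s₂ =>
        obtain ⟨R, h, r₁, r₂, hp⟩ := main s₁ s₂
        exact ⟨.func R, h, .appLocalFun r₁, .appLocalFun r₂, fun hne => by
          simp [Redex.project, hp hne]⟩
      | appGlobalFun s₂ =>
        obtain ⟨R, h, r₁, r₂, hp⟩ := main s₁ s₂
        exact ⟨.func R, h, .appLocalFun r₁, .appGlobalFun r₂, fun hne => by
          simp [Redex.project, hp hne]⟩
    | appGlobalFun s₁ =>
      cases h₂ with
      | appLocalFun s₂ =>
        obtain ⟨R, h, r₁, r₂, hp⟩ := main s₁ s₂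
        exact ⟨.func R, h, .appGlobalFun r₁, .appLocalFun r₂, fun hne => by
          simp [Redex.project, hp hne]⟩
      | appGlobalFun s₂ =>
        obtain ⟨R, h, r₁, r₂, hp⟩ := main s₁ s₂
        exact ⟨.func R, h, .appGlobalFun r₁, .appGlobalFun r₂, fun hne => by
          simp [Redex.project, hp hne]⟩
  | arg _ ih =>
    have main {A A' B B' : Ctrl Loc L} (hA : CtrlStep _ A A') (hB : CtrlStep _ B B') :=
      ih hS hA hB
    cases h₁ with
    | letRetArg s₁ =>
      cases h₂ with
      | letRetArg s₂ =>
        obtain ⟨R, h, r₁, r₂, hp⟩ := main s₁ s₂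
        exact ⟨.arg R, h, .letRetArg r₁, .letRetArg r₂, fun hne => by
          simp [Redex.project, hp hne]⟩
      | appGlobalArg s₂ =>
        obtain ⟨R, h, r₁, r₂, hp⟩ := main s₁ s₂
        exact ⟨.arg R, h, .letRetArg r₁, .appGlobalArg r₂, fun hne => by
          simp [Redex.project, hp hne]⟩
    | appGlobalArg s₁ =>
      cases h₂ with
      | letRetArg s₂ =>
        obtain ⟨R, h, r₁, r₂, hp⟩ := main s₁ s₂
        exact ⟨.arg R, h, .appGlobalArg r₁, .letRetArg r₂, fun hne => by
          simp [Redex.project, hp hne]⟩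
      | appGlobalArg s₂ =>
        obtain ⟨R, h, r₁, r₂, hp⟩ := main s₁ s₂
        exact ⟨.arg R, h, .appGlobalArg r₁, .appGlobalArg r₂, fun hne => by
          simp [Redex.project, hp hne]⟩

/-- A step of a merged program is a step of both programs, unless it is an external choice that
only one of them offers, while the other one offers only the opposite choice. -/
theorem Ctrl.Merges.redexStep {ℓ : Loc} {R : Redex Loc L} {A B E E' : Ctrl Loc L}
    (hm : Merges A B E) (hs : RedexStep ℓ R E E') :
    (∃ A' B', RedexStep ℓ R A A' ∧ RedexStep ℓ R B B' ∧ Merges A' B' E') ∨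
      (∃ ℓ₁, R.IsSync ℓ₁ ℓ) ∧
        ((∃ A' B', RedexStep ℓ R A A' ∧ RedexStep ℓ R.flip B B') ∨
          ∃ A' B', RedexStep ℓ R.flip A A' ∧ RedexStep ℓ R B B') := by
  induction hm generalizing R E' with
  | var => cases hs
  | unit => cases hs
  | funLocal => cases hs
  | funGlobal => cases hs
  | ret =>
    cases hs with | retE h => exact .inl ⟨_, _, .retE h, .retE h, .ret⟩
  | ite h₁ h₂ =>
    cases hs with
    | ifE h => exact .inl ⟨_, _, .ifE h, .ifE h, .ite h₁ h₂⟩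
    | ifTrue => exact .inl ⟨_, _, .ifTrue, .ifTrue, h₁⟩
    | ifFalse => exact .inl ⟨_, _, .ifFalse, .ifFalse, h₂⟩
  | send h₁ =>
    cases hs with
    | sendE h => exact .inl ⟨_, _, .sendE h, .sendE h, .send h₁⟩
    | sendV h => exact .inl ⟨_, _, .sendV h, .sendV h, h₁⟩
  | recv h₁ =>
    cases hs with | recvV h => exact .inl ⟨_, _, .recvV h, .recvV h, h₁.localSubst _⟩
  | choose h₁ => cases hs; exact .inl ⟨_, _, .choose, .choose, h₁⟩
  | allowLL h₁ => cases hs; exact .inl ⟨_, _, .allowL, .allowL, h₁⟩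
  | allowRR h₁ => cases hs; exact .inl ⟨_, _, .allowR, .allowR, h₁⟩
  | allowL_R =>
    cases hs with
    | allowLRLeft => exact .inr ⟨⟨_, rfl, rfl⟩, .inl ⟨_, _, .allowL, .allowR⟩⟩
    | allowLRRight => exact .inr ⟨⟨_, rfl, rfl⟩, .inr ⟨_, _, .allowL, .allowR⟩⟩
  | allowR_L =>
    cases hs with
    | allowLRLeft => exact .inr ⟨⟨_, rfl, rfl⟩, .inr ⟨_, _, .allowR, .allowL⟩⟩
    | allowLRRight => exact .inr ⟨⟨_, rfl, rfl⟩, .inl ⟨_, _, .allowR, .allowL⟩⟩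
  | allowL_LR h₁ =>
    cases hs with
    | allowLRLeft => exact .inl ⟨_, _, .allowL, .allowLRLeft, h₁⟩
    | allowLRRight => exact .inr ⟨⟨_, rfl, rfl⟩, .inr ⟨_, _, .allowL, .allowLRRight⟩⟩
  | allowR_LR h₁ =>
    cases hs with
    | allowLRLeft => exact .inr ⟨⟨_, rfl, rfl⟩, .inr ⟨_, _, .allowR, .allowLRLeft⟩⟩
    | allowLRRight => exact .inl ⟨_, _, .allowR, .allowLRRight, h₁⟩
  | allowLR_L h₁ =>
    cases hs with
    | allowLRLeft => exact .inl ⟨_, _, .allowLRLeft, .allowL, h₁⟩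
    | allowLRRight => exact .inr ⟨⟨_, rfl, rfl⟩, .inl ⟨_, _, .allowLRRight, .allowL⟩⟩
  | allowLR_R h₁ =>
    cases hs with
    | allowLRLeft => exact .inr ⟨⟨_, rfl, rfl⟩, .inl ⟨_, _, .allowLRLeft, .allowR⟩⟩
    | allowLRRight => exact .inl ⟨_, _, .allowLRRight, .allowR, h₁⟩
  | allowLR h₁ h₂ =>
    cases hs with
    | allowLRLeft => exact .inl ⟨_, _, .allowLRLeft, .allowLRLeft, h₁⟩
    | allowLRRight => exact .inl ⟨_, _, .allowLRRight, .allowLRRight, h₂⟩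
  | letRet _ h₂ ih =>
    cases hs with | letRetArg s =>
    rcases ih s with ⟨_, _, a, b, h⟩ | ⟨hR, ⟨_, _, a, b⟩ | ⟨_, _, a, b⟩⟩
    · exact .inl ⟨_, _, .letRetArg a, .letRetArg b, .letRet h h₂⟩
    · exact .inr ⟨hR, .inl ⟨_, _, .letRetArg a, .letRetArg b⟩⟩
    · exact .inr ⟨hR, .inr ⟨_, _, .letRetArg a, .letRetArg b⟩⟩
  | appLocal h₁ ih =>
    cases hs with
    | appLocalArg h => exact .inl ⟨_, _, .appLocalArg h, .appLocalArg h, .appLocal h₁⟩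
    | appLocalFun s =>
      rcases ih s with ⟨_, _, a, b, h⟩ | ⟨hR, ⟨_, _, a, b⟩ | ⟨_, _, a, b⟩⟩
      · exact .inl ⟨_, _, .appLocalFun a, .appLocalFun b, .appLocal h⟩
      · exact .inr ⟨hR, .inl ⟨_, _, .appLocalFun a, .appLocalFun b⟩⟩
      · exact .inr ⟨hR, .inr ⟨_, _, .appLocalFun a, .appLocalFun b⟩⟩
  | appGlobal h₁ h₂ ih₁ ih₂ =>
    cases hs with
    | appGlobalFun s =>
      rcases ih₁ s with ⟨_, _, a, b, h⟩ | ⟨hR, ⟨_, _, a, b⟩ | ⟨_, _, a, b⟩⟩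
      · exact .inl ⟨_, _, .appGlobalFun a, .appGlobalFun b, .appGlobal h h₂⟩
      · exact .inr ⟨hR, .inl ⟨_, _, .appGlobalFun a, .appGlobalFun b⟩⟩
      · exact .inr ⟨hR, .inr ⟨_, _, .appGlobalFun a, .appGlobalFun b⟩⟩
    | appGlobalArg s =>
      rcases ih₂ s with ⟨_, _, a, b, h⟩ | ⟨hR, ⟨_, _, a, b⟩ | ⟨_, _, a, b⟩⟩
      · exact .inl ⟨_, _, .appGlobalArg a, .appGlobalArg b, .appGlobal h₁ h⟩
      · exact .inr ⟨hR, .inl ⟨_, _, .appGlobalArg a, .appGlobalArg b⟩⟩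
      · exact .inr ⟨hR, .inr ⟨_, _, .appGlobalArg a, .appGlobalArg b⟩⟩

/-! ### Lifting local steps, communications and choices to choreographies. -/

theorem notMem_union_singleton {α : Type*} {B : Set α} {a x : α} (hB : x ∉ B) (h : a ≠ x) :
    x ∉ B ∪ {a} := by
  simp [hB, h.symm]

theorem notMem_union_pair {α : Type*} {B : Set α} {a b x : α} (hB : x ∉ B) (h₁ : a ≠ x)
    (h₂ : b ≠ x) : x ∉ B ∪ {a, b} := by
  simp [hB, h₁.symm, h₂.symm]

/-- The block set must vary in the induction: each skipped prefix or `if` enlarges it, but never by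
`ℓ`. The redex is fixed in advance, so the two branches of an `if` elsewhere step alike and their
results still merge. -/
theorem Projects.exists_chorStep_of_isLocal {ℓ : Loc} {C : Chor Loc L} {P E : Ctrl Loc L}
    {R : Redex Loc L} {B : Set Loc} (h : Projects ℓ C P) (hs : RedexStep ℓ R P E)
    (hR : R.IsLocal) (hB : ℓ ∉ B) : ∃ C', Projects ℓ C' E ∧ ChorStep R B C C' := by
  induction h generalizing R E B with
  | done => cases hs with | retE s => exact ⟨_, .done, .doneE hB s⟩
  | send hne h =>
    cases hs with
    | sendE s => exact ⟨_, .send hne h, .sendE hB hne s⟩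
    | sendV => exact hR.elim
  | send_ne h₁ h₂ _ ih =>
    obtain ⟨C', hC', s⟩ := ih hs hR (notMem_union_pair hB h₁ h₂)
    exact ⟨_, .send_ne h₁ h₂ hC', .sendI s⟩
  | ite h₁ h₂ =>
    cases hs with
    | ifE s => exact ⟨_, .ite h₁ h₂, .ifE hB s⟩
    | ifTrue => exact ⟨_, h₁, .ifT hB⟩
    | ifFalse => exact ⟨_, h₂, .ifF hB⟩
  | ite_ne hne _ _ hm ih₁ ih₂ =>
    -- Merging can break the step apart only for a synchronization, which is not a local redex.
    rcases hm.redexStep hs with ⟨A', B', s₁, s₂, hm'⟩ | ⟨⟨_, h⟩, _⟩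
    · obtain ⟨C₁', hC₁, t₁⟩ := ih₁ s₁ hR (notMem_union_singleton hB hne)
      obtain ⟨C₂', hC₂, t₂⟩ := ih₂ s₂ hR (notMem_union_singleton hB hne)
      exact ⟨_, .ite_ne hne hC₁ hC₂ hm', .ifI t₁ t₂⟩
    · exact (h.not_isLocal hR).elim
  | sync_ne h₁ h₂ _ ih =>
    obtain ⟨C', hC', s⟩ := ih hs hR (notMem_union_pair hB h₁ h₂)
    exact ⟨_, .sync_ne h₁ h₂ hC', .syncI s⟩
  | defLocal _ h₂ ih =>
    cases hs with | letRetArg s =>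
    obtain ⟨C', hC', t⟩ := ih s hR hB
    exact ⟨_, .defLocal hC' h₂, .defLocalI t⟩
  | defLocal_ne hne _ h₂ ih =>
    cases hs with
    | appGlobalFun s => cases s
    | appGlobalArg s =>
      obtain ⟨C', hC', t⟩ := ih s hR hB
      exact ⟨_, .defLocal_ne hne hC' h₂, .defLocalI t⟩
  | appLocal h ih =>
    cases hs with
    | appLocalFun s =>
      obtain ⟨C', hC', t⟩ := ih s hR hB
      exact ⟨_, .appLocal hC', .appLocalFun t⟩
    | appLocalArg s => exact ⟨_, .appLocal h, .appLocalArg hB s⟩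
  | appLocal_ne hne _ ih =>
    cases hs with
    | appGlobalFun s =>
      obtain ⟨C', hC', t⟩ := ih s hR hB
      exact ⟨_, .appLocal_ne hne hC', .appLocalFun t⟩
    | appGlobalArg s => cases s
  | appGlobal h₁ h₂ ih₁ ih₂ =>
    cases hs with
    | appGlobalFun s =>
      obtain ⟨C', hC', t⟩ := ih₁ s hR hB
      exact ⟨_, .appGlobal hC' h₂, .appGlobalFun t⟩
    | appGlobalArg s =>
      obtain ⟨C', hC', t⟩ := ih₂ s hR hB
      exact ⟨_, .appGlobal h₁ hC', .appGlobalArg t⟩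
  | recv => cases hs; exact hR.elim
  | choose => cases hs; exact hR.elim
  | allowL => cases hs; exact hR.elim
  | allowR => cases hs; exact hR.elim
  | _ => cases hs

/-- Projection is undefined on self-communication at the location concerned, so a projected program
never reaches a communication whose partner is itself. Under a merge it is enough that at least one
branch takes the step with the unflipped redex. -/
theorem Projects.not_isBetween_self {ℓ : Loc} {C : Chor Loc L} {P E : Ctrl Loc L}
    {R : Redex Loc L} (h : Projects ℓ C P) (hs : RedexStep ℓ R P E) : ¬ R.IsBetween ℓ ℓ := by
  induction h generalizing R E with
  | send_ne _ _ _ ih => exact ih hs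
  | sync_ne _ _ _ ih => exact ih hs
  | ite_ne _ _ _ hm ih₁ ih₂ =>
    rcases hm.redexStep hs with ⟨_, _, s, _⟩ | ⟨_, ⟨_, _, s, _⟩ | ⟨_, _, _, s⟩⟩
    · exact fun h => ih₁ s h
    · exact fun h => ih₁ s h
    · exact fun h => ih₂ s h
  | send hne =>
    cases hs with
    | sendE => exact id
    | sendV => exact fun h => hne h.2.symm
  | recv hne => cases hs; exact fun h => hne h.1
  | choose hne => cases hs; exact fun h => hne h.2.symm
  | allowL hne => cases hs; exact fun h => hne h.1
  | allowR hne => cases hs; exact fun h => hne h.1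
  | defLocal _ _ ih => cases hs with | letRetArg s => exact fun h => ih s h
  | defLocal_ne _ _ _ ih =>
    cases hs with
    | appGlobalFun s => cases s
    | appGlobalArg s => exact fun h => ih s h
  | appLocal _ ih =>
    cases hs with
    | appLocalFun s => exact fun h => ih s h
    | appLocalArg => exact id
  | appLocal_ne _ _ ih =>
    cases hs with
    | appGlobalFun s => exact fun h => ih s h
    | appGlobalArg s => cases s
  | appGlobal _ _ ih₁ ih₂ =>
    cases hs with
    | appGlobalFun s => exact fun h => ih₁ s h
    | appGlobalArg s => exact fun h => ih₂ s h
  | done => cases hs; exact id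
  | ite => cases hs <;> exact id
  | _ => cases hs

/-- A program that is ready to choose a synchronization label is not matched by an external choice
that offers the opposite label. -/
theorem Projects.not_redexStep_flip {ℓ₁ ℓ₂ : Loc} (hne : ℓ₁ ≠ ℓ₂) {C : Chor Loc L}
    {P₁ P₂ E₁ E₂ : Ctrl Loc L} {R F : Redex Loc L} (h₁ : Projects ℓ₁ C P₁)
    (h₂ : Projects ℓ₂ C P₂) (s₁ : RedexStep ℓ₁ R P₁ E₁) (s₂ : RedexStep ℓ₂ F P₂ E₂)
    (hF : R.flip = F) : ¬ R.IsSync ℓ₁ ℓ₂ := by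
  intro hR
  -- Both redices are synchronizations between the same locations, so steps of another kind are
  -- refuted on either side. Keeping `F` as a variable lets `s₂` be inspected before `R.flip` is
  -- computed.
  have hR' := hF ▸ hR.flip
  induction h₁ generalizing R F P₂ E₁ E₂ with
  | var => cases s₁
  | done => cases s₁; exact hR
  | done_ne => cases s₁
  | send => cases s₁ <;> exact hR
  | recv => cases s₁; exact hR
  | send_ne _ _ _ ih =>
    cases h₂ with
    | send => cases s₂ <;> exact hR'
    | recv => cases s₂; exact hR'
    | send_ne _ _ h₂ => exact ih h₂ s₁ s₂ hF hR hR'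
  | ite => cases s₁ <;> exact hR
  | ite_ne _ _ _ hm ih₁ ih₂ =>
    cases h₂ with
    | ite => cases s₂ <;> exact hR'
    | ite_ne _ h₂ h₂' hm' =>
      -- The sender steps in both branches, as the exceptional case would make it the receiver. The
      -- receiver takes the flipped step in at least one branch, and the contradiction arises in
      -- that branch.
      rcases hm.redexStep s₁ with ⟨_, _, a, b, _⟩ | ⟨⟨_, h⟩, _⟩
      · rcases hm'.redexStep s₂ with ⟨_, _, s, _⟩ | ⟨_, ⟨_, _, s, _⟩ | ⟨_, _, _, s⟩⟩
        · exact ih₁ h₂ a s hF hR hR'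
        · exact ih₁ h₂ a s hF hR hR'
        · exact ih₂ h₂' b s hF hR hR'
      · exact hne (h.eq_of_isBetween hR.isBetween).2
  | choose =>
    cases s₁
    cases h₂ with
    | choose => exact hne rfl
    | allowL => cases s₂; simp [Redex.flip, SyncLabel.flip] at hF
    | allowR => cases s₂; simp [Redex.flip, SyncLabel.flip] at hF
    | sync_ne _ h => exact h hR.2
  | allowL => cases s₁; exact hne hR.2
  | allowR => cases s₁; exact hne hR.2
  | sync_ne h _ _ ih =>
    cases h₂ with
    | choose => cases s₂; exact hne hR'.1.symm
    | allowL => cases s₂; exact h hR'.1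
    | allowR => cases s₂; exact h hR'.1
    | sync_ne _ _ h₂ => exact ih h₂ s₁ s₂ hF hR hR'
  | defLocal _ _ ih =>
    cases s₁ with | letRetArg s₁ =>
    subst hF
    cases h₂ with
    | defLocal => exact hne rfl
    | defLocal_ne _ h₂ => cases s₂ with | appGlobalArg s₂ => exact ih h₂ s₁ s₂ rfl hR hR'
  | defLocal_ne _ _ _ ih =>
    cases s₁ with
    | appGlobalFun s => cases s
    | appGlobalArg s₁ =>
      subst hF
      cases h₂ with
      | defLocal h₂ => cases s₂ with | letRetArg s₂ => exact ih h₂ s₁ s₂ rfl hR hR'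
      | defLocal_ne _ h₂ => cases s₂ with | appGlobalArg s₂ => exact ih h₂ s₁ s₂ rfl hR hR'
  | funLocal => cases s₁
  | funLocal_ne => cases s₁
  | appLocal _ ih =>
    cases s₁ with
    | appLocalArg => exact hR
    | appLocalFun s₁ =>
      subst hF
      cases h₂ with
      | appLocal => exact hne rfl
      | appLocal_ne _ h₂ => cases s₂ with | appGlobalFun s₂ => exact ih h₂ s₁ s₂ rfl hR hR'
  | appLocal_ne _ _ ih =>
    cases s₁ with
    | appGlobalArg s => cases s
    | appGlobalFun s₁ =>
      subst hF
      cases h₂ with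
      | appLocal h₂ => cases s₂ with | appLocalFun s₂ => exact ih h₂ s₁ s₂ rfl hR hR'
      | appLocal_ne _ h₂ => cases s₂ with | appGlobalFun s₂ => exact ih h₂ s₁ s₂ rfl hR hR'
  | funGlobal => cases s₁
  | appGlobal _ _ ih₁ ih₂ =>
    cases h₂ with | appGlobal h₂ h₂' =>
    subst hF
    cases s₁ with
    | appGlobalFun s₁ => cases s₂ with | appGlobalFun s₂ => exact ih₁ h₂ s₁ s₂ rfl hR hR'
    | appGlobalArg s₁ => cases s₂ with | appGlobalArg s₂ => exact ih₂ h₂' s₁ s₂ rfl hR hR'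

/-- The two projections are followed in parallel through the same choreography. A construct skipped
by both blocks neither; one that involves exactly one of them cannot be passed by that location, so
the common redex refutes it. -/
theorem Projects.exists_chorStep_of_isBetween {ℓ₁ ℓ₂ : Loc} (hne : ℓ₁ ≠ ℓ₂) {C : Chor Loc L}
    {P₁ P₂ E₁ E₂ : Ctrl Loc L} {R : Redex Loc L} {B : Set Loc} (h₁ : Projects ℓ₁ C P₁)
    (h₂ : Projects ℓ₂ C P₂) (s₁ : RedexStep ℓ₁ R P₁ E₁) (s₂ : RedexStep ℓ₂ R P₂ E₂)
    (hR : R.IsBetween ℓ₁ ℓ₂) (hB₁ : ℓ₁ ∉ B) (hB₂ : ℓ₂ ∉ B) :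
    ∃ C', Projects ℓ₁ C' E₁ ∧ Projects ℓ₂ C' E₂ ∧ ChorStep R B C C' := by
  induction h₁ generalizing R P₂ E₁ E₂ B with
  | var => cases s₁
  | done => cases s₁; exact hR.elim
  | done_ne => cases s₁
  | send _ h₁ =>
    cases s₁ with
    | sendE => exact hR.elim
    | sendV hv =>
      obtain rfl := hR.2
      cases h₂ with
      | send => exact (hne rfl).elim
      | send_ne _ h => exact (h rfl).elim
      | recv _ h₂ =>
        cases s₂ with
        -- The received value replaces a variable of `ℓ₂`, which the sender does not see.
        | recvV => exact ⟨_, h₁.localSubst_ne hne.symm _, h₂.localSubst _, .sendV hB₁ hB₂ hv hne⟩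
  | recv => cases s₁; exact (hne hR.2).elim
  | send_ne a b _ ih =>
    cases h₂ with
    | send =>
      cases s₂ with
      | sendE => exact hR.elim
      | sendV => exact (hne hR.1.symm).elim
    | recv => cases s₂; exact (a hR.1).elim
    | send_ne a' b' h₂ =>
      obtain ⟨C', hC₁, hC₂, s⟩ := ih h₂ s₁ s₂ hR
        (notMem_union_pair hB₁ a b) (notMem_union_pair hB₂ a' b')
      exact ⟨_, .send_ne a b hC₁, .send_ne a' b' hC₂, .sendI s⟩
  | ite => cases s₁ <;> exact hR.elim
  | ite_ne a h₁ h₁' hm ih₁ ih₂ =>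
    cases h₂ with
    | ite => cases s₂ <;> exact hR.elim
    | ite_ne a' h₂ h₂' hm' =>
      rcases hm.redexStep s₁ with ⟨_, _, s₁, s₁', hm⟩ | ⟨⟨_, h⟩, _⟩
      · rcases hm'.redexStep s₂ with ⟨_, _, s₂, s₂', hm'⟩ | ⟨⟨_, h⟩, ⟨_, _, _, s⟩ | ⟨_, _, s, _⟩⟩
        · obtain ⟨C, hC₁, hC₂, t⟩ := ih₁ h₂ s₁ s₂ hR
            (notMem_union_singleton hB₁ a) (notMem_union_singleton hB₂ a')
          obtain ⟨D, hD₁, hD₂, t'⟩ := ih₂ h₂' s₁' s₂' hR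
            (notMem_union_singleton hB₁ a) (notMem_union_singleton hB₂ a')
          exact ⟨_, .ite_ne a hC₁ hD₁ hm, .ite_ne a' hC₂ hD₂ hm', .ifI t t'⟩
        -- Here the receiver offers only the opposite label in the second branch, where the sender
        -- still makes its choice; the next case is the same for the first branch.
        · obtain ⟨rfl, _⟩ := h.eq_of_isBetween hR
          exact (h₁'.not_redexStep_flip hne h₂' s₁' s rfl h).elim
        · obtain ⟨rfl, _⟩ := h.eq_of_isBetween hR
          exact (h₁.not_redexStep_flip hne h₂ s₁ s rfl h).elim
      · exact (hne (h.eq_of_isBetween hR).2).elim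
  | choose _ h₁ =>
    cases s₁
    cases h₂ with
    | choose => exact (hne rfl).elim
    | allowL _ h₂ => cases s₂; exact ⟨_, h₁, h₂, .sync hB₁ hB₂ hne⟩
    | allowR _ h₂ => cases s₂; exact ⟨_, h₁, h₂, .sync hB₁ hB₂ hne⟩
    | sync_ne _ h => exact (h hR.2).elim
  | allowL => cases s₁; exact (hne hR.2).elim
  | allowR => cases s₁; exact (hne hR.2).elim
  | sync_ne a b _ ih =>
    cases h₂ with
    | choose => cases s₂; exact (hne hR.1.symm).elim
    | allowL => cases s₂; exact (a hR.1).elim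
    | allowR => cases s₂; exact (a hR.1).elim
    | sync_ne a' b' h₂ =>
      obtain ⟨C', hC₁, hC₂, s⟩ := ih h₂ s₁ s₂ hR
        (notMem_union_pair hB₁ a b) (notMem_union_pair hB₂ a' b')
      exact ⟨_, .sync_ne a b hC₁, .sync_ne a' b' hC₂, .syncI s⟩
  | defLocal _ h₁' ih =>
    cases s₁ with | letRetArg s₁ =>
    cases h₂ with
    | defLocal => exact (hne rfl).elim
    | defLocal_ne a' h₂ h₂' =>
      cases s₂ with | appGlobalArg s₂ =>
      obtain ⟨C', hC₁, hC₂, t⟩ := ih h₂ s₁ s₂ hR hB₁ hB₂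
      exact ⟨_, .defLocal hC₁ h₁', .defLocal_ne a' hC₂ h₂', .defLocalI t⟩
  | defLocal_ne a _ h₁' ih =>
    cases s₁ with
    | appGlobalFun s => cases s
    | appGlobalArg s₁ =>
      cases h₂ with
      | defLocal h₂ h₂' =>
        cases s₂ with | letRetArg s₂ =>
        obtain ⟨C', hC₁, hC₂, t⟩ := ih h₂ s₁ s₂ hR hB₁ hB₂
        exact ⟨_, .defLocal_ne a hC₁ h₁', .defLocal hC₂ h₂', .defLocalI t⟩
      | defLocal_ne a' h₂ h₂' =>
        cases s₂ with | appGlobalArg s₂ =>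
        obtain ⟨C', hC₁, hC₂, t⟩ := ih h₂ s₁ s₂ hR hB₁ hB₂
        exact ⟨_, .defLocal_ne a hC₁ h₁', .defLocal_ne a' hC₂ h₂', .defLocalI t⟩
  | funLocal => cases s₁
  | funLocal_ne => cases s₁
  | appLocal _ ih =>
    cases s₁ with
    | appLocalArg => exact hR.elim
    | appLocalFun s₁ =>
      cases h₂ with
      | appLocal => exact (hne rfl).elim
      | appLocal_ne a' h₂ =>
        cases s₂ with | appGlobalFun s₂ =>
        obtain ⟨C', hC₁, hC₂, t⟩ := ih h₂ s₁ s₂ hR hB₁ hB₂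
        exact ⟨_, .appLocal hC₁, .appLocal_ne a' hC₂, .appLocalFun t⟩
  | appLocal_ne a _ ih =>
    cases s₁ with
    | appGlobalArg s => cases s
    | appGlobalFun s₁ =>
      cases h₂ with
      | appLocal h₂ =>
        cases s₂ with | appLocalFun s₂ =>
        obtain ⟨C', hC₁, hC₂, t⟩ := ih h₂ s₁ s₂ hR hB₁ hB₂
        exact ⟨_, .appLocal_ne a hC₁, .appLocal hC₂, .appLocalFun t⟩
      | appLocal_ne a' h₂ =>
        cases s₂ with | appGlobalFun s₂ =>
        obtain ⟨C', hC₁, hC₂, t⟩ := ih h₂ s₁ s₂ hR hB₁ hB₂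
        exact ⟨_, .appLocal_ne a hC₁, .appLocal_ne a' hC₂, .appLocalFun t⟩
  | funGlobal => cases s₁
  | appGlobal h₁ h₁' ih₁ ih₂ =>
    cases h₂ with | appGlobal h₂ h₂' =>
    cases s₁ with
    | appGlobalFun s₁ =>
      cases s₂ with | appGlobalFun s₂ =>
      obtain ⟨C', hC₁, hC₂, t⟩ := ih₁ h₂ s₁ s₂ hR hB₁ hB₂
      exact ⟨_, .appGlobal hC₁ h₁', .appGlobal hC₂ h₂', .appGlobalFun t⟩
    | appGlobalArg s₁ =>
      cases s₂ with | appGlobalArg s₂ =>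
      obtain ⟨C', hC₁, hC₂, t⟩ := ih₂ h₂' s₁ s₂ hR hB₁ hB₂
      exact ⟨_, .appGlobal h₁ hC₁, .appGlobal h₂ hC₂, .appGlobalArg t⟩

/-- A communication or choice on which two locations agree is a step of the choreography. -/
theorem LabelMerge.exists_chorStep {l₁ l₂ : Label Loc L} {S : SysLabel Loc L} {ℓ₁ ℓ₂ : Loc}
    (hl : LabelMerge l₁ l₂ S) (hS : S.IsBetween ℓ₁ ℓ₂) {C : Chor Loc L}
    {P₁ P₂ E₁ E₂ : Ctrl Loc L} (h₁ : C.project ℓ₁ = some P₁) (h₂ : C.project ℓ₂ = some P₂)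
    (s₁ : CtrlStep l₁ P₁ E₁) (s₂ : CtrlStep l₂ P₂ E₂) :
    ∃ (R : Redex Loc L) (C₂ : Chor Loc L), C₂.project ℓ₁ = some E₁ ∧ C₂.project ℓ₂ = some E₂ ∧
      R.project ℓ₁ = some l₁ ∧ R.project ℓ₂ = some l₂ ∧ ChorStep R ∅ C C₂ := by
  simp only [project_eq_some_iff] at h₁ h₂ ⊢
  obtain ⟨R, hR, r₁, r₂, hp⟩ := hl.exists_redexStep hS s₁ s₂
  -- Label merging alone does not exclude a location talking to itself.
  have hne : ℓ₁ ≠ ℓ₂ := by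
    rintro rfl
    exact h₁.not_isBetween_self r₁ hR
  obtain ⟨C₂, hC₁, hC₂, t⟩ :=
    h₁.exists_chorStep_of_isBetween hne h₂ r₁ r₂ hR (Set.notMem_empty _) (Set.notMem_empty _)
  exact ⟨R, C₂, hC₁, hC₂, (hp hne).1, (hp hne).2, t⟩

/-! ### Choreographies all of whose projections are values -/

/-! ### Choreographies determined by their projections -/

/-- Returned expressions, the unit value and functions. -/
def Ctrl.IsIntro : Ctrl Loc L → Prop
  | unit | ret _ | funLocal _ | funGlobal _ => True
  | _ => False

theorem Ctrl.IsValue.isIntro {E : Ctrl Loc L} (h : E.IsValue) : E.IsIntro := by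
  cases h <;> trivial

namespace Chor

variable {𝔏 : Set Loc} {C : Chor Loc L}

/-- One projection is not enough, since it may skip prefixes. A leading send, synchronization or
`if` is visible at its acting location, which belongs to `𝔏`. Variables, `let` and applications are
visible everywhere, so any element of `𝔏` rules them out. -/
theorem cases_of_projects_isIntro (hne : 𝔏.Nonempty) (hL : C.locationNames ⊆ 𝔏)
    (h : ∀ ℓ ∈ 𝔏, ∃ E, Projects ℓ C E ∧ E.IsIntro) :
    (∃ ℓ e, C = done ℓ e) ∨ (∃ ℓ D, C = funLocal ℓ D) ∨ ∃ D, C = funGlobal D := by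
  obtain ⟨ℓ₀, h₀⟩ := hne
  cases C with
  | done => exact .inl ⟨_, _, rfl⟩
  | funLocal => exact .inr (.inl ⟨_, _, rfl⟩)
  | funGlobal => exact .inr (.inr ⟨_, rfl⟩)
  | send a e b C =>
    obtain ⟨E, hp, hE⟩ := h a (hL (by simp [locationNames]))
    cases hp with
    | send => exact hE.elim
    | recv => exact hE.elim
    | send_ne h => exact (h rfl).elim
  | ite a e C₁ C₂ =>
    obtain ⟨E, hp, hE⟩ := h a (hL (by simp [locationNames]))
    cases hp with
    | ite => exact hE.elim
    | ite_ne h => exact (h rfl).elim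
  | sync a d b C =>
    obtain ⟨E, hp, hE⟩ := h a (hL (by simp [locationNames]))
    cases hp with
    | choose => exact hE.elim
    | allowL => exact hE.elim
    | allowR => exact hE.elim
    | sync_ne h => exact (h rfl).elim
  | _ =>
    obtain ⟨E, hp, hE⟩ := h ℓ₀ h₀
    cases hp <;> exact hE.elim

/-- Every expression is kept by the projection to its own location, and every choreography variable
by all projections; a location of `𝔏` is still needed to see the latter. -/
theorem closedBelow_of_projects (hne : 𝔏.Nonempty) (hL : C.locationNames ⊆ 𝔏) {n : ℕ}
    {k : Loc → ℕ} (h : ∀ ℓ ∈ 𝔏, ∃ E, Projects ℓ C E ∧ E.ClosedBelow n (k ℓ)) :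
    C.ClosedBelow n k := by
  induction C generalizing n k with
  | var X =>
    obtain ⟨ℓ₀, h₀⟩ := hne
    obtain ⟨E, hp, hE⟩ := h ℓ₀ h₀
    cases hp
    exact hE
  | done ℓ e =>
    obtain ⟨E, hp, hE⟩ := h ℓ (hL (by simp [locationNames]))
    cases hp with
    | done => exact hE
    | done_ne h => exact (h rfl).elim
  | send a e b C ih =>
    refine ⟨?_, ih (fun x hx => hL (.inr hx)) fun ℓ hℓ => ?_⟩
    · obtain ⟨E, hp, hE⟩ := h a (hL (by simp [locationNames]))
      cases hp with
      | send => exact hE.1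
      | recv => contradiction
      | send_ne h => exact (h rfl).elim
    · obtain ⟨E, hp, hE⟩ := h ℓ hℓ
      cases hp with
      | send h hp => exact ⟨_, hp, by simpa [h] using hE.2⟩
      | recv _ hp => exact ⟨_, hp, by simpa [Ctrl.ClosedBelow] using hE⟩
      | send_ne _ h hp => exact ⟨_, hp, by simpa [h.symm] using hE⟩
  | ite a e C₁ C₂ ih₁ ih₂ =>
    refine ⟨?_, ih₁ (fun x hx => hL (.inl (.inr hx))) fun ℓ hℓ => ?_,
      ih₂ (fun x hx => hL (.inr hx)) fun ℓ hℓ => ?_⟩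
    · obtain ⟨E, hp, hE⟩ := h a (hL (by simp [locationNames]))
      cases hp with
      | ite => exact hE.1
      | ite_ne h => exact (h rfl).elim
    · obtain ⟨E, hp, hE⟩ := h ℓ hℓ
      cases hp with
      | ite hp => exact ⟨_, hp, hE.2.1⟩
      | ite_ne _ hp _ hm => exact ⟨_, hp, (hm.closedBelow hE).1⟩
    · obtain ⟨E, hp, hE⟩ := h ℓ hℓ
      cases hp with
      | ite _ hp => exact ⟨_, hp, hE.2.2⟩
      | ite_ne _ _ hp hm => exact ⟨_, hp, (hm.closedBelow hE).2⟩
  | sync a d b C ih =>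
    refine ih (fun x hx => hL (.inr hx)) fun ℓ hℓ => ?_
    obtain ⟨E, hp, hE⟩ := h ℓ hℓ
    cases hp with
    | choose _ hp => exact ⟨_, hp, hE⟩
    | allowL _ hp => exact ⟨_, hp, hE⟩
    | allowR _ hp => exact ⟨_, hp, hE⟩
    | sync_ne _ _ hp => exact ⟨_, hp, hE⟩
  | defLocal a C₁ C₂ ih₁ ih₂ =>
    refine ⟨ih₁ (fun x hx => hL (.inl (.inr hx))) fun ℓ hℓ => ?_,
      ih₂ (fun x hx => hL (.inr hx)) fun ℓ hℓ => ?_⟩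
    · obtain ⟨E, hp, hE⟩ := h ℓ hℓ
      cases hp with
      | defLocal hp => exact ⟨_, hp, hE.1⟩
      | defLocal_ne _ hp => exact ⟨_, hp, hE.2⟩
    · obtain ⟨E, hp, hE⟩ := h ℓ hℓ
      cases hp with
      | defLocal _ hp => exact ⟨_, hp, by simpa using hE.2⟩
      | defLocal_ne h _ hp =>
        exact ⟨_, hp, by simpa [h.symm] using hE.1.of_rename (n := n) fun i hi => by omega⟩
  | funLocal a C ih =>
    refine ih (fun x hx => hL (.inr hx)) fun ℓ hℓ => ?_
    obtain ⟨E, hp, hE⟩ := h ℓ hℓ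
    cases hp with
    | funLocal hp => exact ⟨_, hp, by simpa [Ctrl.ClosedBelow] using hE⟩
    | funLocal_ne h hp =>
      -- Of the two variables bound by the projected function only the argument is fresh; the
      -- function name remains, whence `n + 1` and not `n`.
      have hE := Ctrl.ClosedBelow.of_rename (n := n + 1) hE fun i hi => by omega
      exact ⟨_, hp, by simpa [h.symm] using hE⟩
  | funGlobal C ih =>
    refine ih hL fun ℓ hℓ => ?_
    obtain ⟨E, hp, hE⟩ := h ℓ hℓ
    cases hp with | funGlobal hp => exact ⟨_, hp, hE⟩
  | appLocal a C e ih =>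
    refine ⟨ih (fun x hx => hL (.inr hx)) fun ℓ hℓ => ?_, ?_⟩
    · obtain ⟨E, hp, hE⟩ := h ℓ hℓ
      cases hp with
      | appLocal hp => exact ⟨_, hp, hE.1⟩
      | appLocal_ne _ hp => exact ⟨_, hp, hE.1⟩
    · obtain ⟨E, hp, hE⟩ := h a (hL (by simp [locationNames]))
      cases hp with
      | appLocal => exact hE.2
      | appLocal_ne h => exact (h rfl).elim
  | appGlobal C₁ C₂ ih₁ ih₂ =>
    refine ⟨ih₁ (fun x hx => hL (.inl hx)) fun ℓ hℓ => ?_,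
      ih₂ (fun x hx => hL (.inr hx)) fun ℓ hℓ => ?_⟩
    · obtain ⟨E, hp, hE⟩ := h ℓ hℓ
      cases hp with | appGlobal hp => exact ⟨_, hp, hE.1⟩
    · obtain ⟨E, hp, hE⟩ := h ℓ hℓ
      cases hp with | appGlobal _ hp => exact ⟨_, hp, hE.2⟩

theorem isValue_of_projects (hne : 𝔏.Nonempty) (hL : C.locationNames ⊆ 𝔏)
    (h : ∀ ℓ ∈ 𝔏, ∃ E, Projects ℓ C E ∧ E.IsValue) : C.IsValue := by
  rcases cases_of_projects_isIntro hne hL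
    (fun ℓ hℓ => (h ℓ hℓ).imp fun _ hE => ⟨hE.1, hE.2.isIntro⟩) with
    ⟨a, e, rfl⟩ | ⟨a, D, rfl⟩ | ⟨D, rfl⟩
  · obtain ⟨E, hp, hE⟩ := h a (hL (by simp [locationNames]))
    cases hp with
    | done => cases hE with | ret _ hv => exact .done _ _ hv
    | done_ne h => exact (h rfl).elim
  · refine .funLocal _ _ (closedBelow_of_projects hne hL fun ℓ hℓ => ?_)
    obtain ⟨E, hp, hE⟩ := h ℓ hℓ
    refine ⟨E, hp, ?_⟩
    cases hp with
    | funLocal => cases hE with | funLocal _ hc => exact hc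
    | funLocal_ne => cases hE with | funGlobal _ hc => exact hc
  · refine .funGlobal _ (closedBelow_of_projects hne hL fun ℓ hℓ => ?_)
    obtain ⟨E, hp, hE⟩ := h ℓ hℓ
    refine ⟨E, hp, ?_⟩
    cases hp with
    | funGlobal => cases hE with | funGlobal _ hc => exact hc

end Chor

namespace Projects

variable {ℓ : Loc}

theorem single {C : Chor Loc L} {E : Ctrl Loc L} (h : Projects ℓ C E) (n : ℕ) :
    Projects ℓ (Chor.single C n) (Ctrl.single E n) := by
  cases n with
  | zero => exact h
  | succ n => exact .var

theorem double {C D : Chor Loc L} {E F : Ctrl Loc L} (h : Projects ℓ C E) (h' : Projects ℓ D F) :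
    ∀ n, Projects ℓ (Chor.double C D n) (Ctrl.double E F n)
  | 0 => h
  | 1 => h'
  | _ + 2 => .var

end Projects

/-! ### Synchronized steps -/

/-- If all projections of a choreography take the same `β`-step, so does the choreography. -/
theorem LabelMerge.exists_chorStep_of_syncIota {𝔏 : Set Loc} (hne : 𝔏.Nonempty)
    {l : Label Loc L} (hl : LabelMerge l l .syncIota) {C : Chor Loc L}
    (hL : C.locationNames ⊆ 𝔏) {E : Loc → Ctrl Loc L}
    (h : ∀ ℓ ∈ 𝔏, ∃ P, Projects ℓ C P ∧ CtrlStep l P (E ℓ)) :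
    ∃ (R : Redex Loc L) (C' : Chor Loc L), (∀ ℓ ∈ 𝔏, R.project ℓ = some l) ∧
      (∀ ℓ ∈ 𝔏, Projects ℓ C' (E ℓ)) ∧ ChorStep R ∅ C C' := by
  obtain ⟨ℓ₀, h₀⟩ := id hne
  induction C generalizing l E with
  | var X =>
    obtain ⟨P, hp, hs⟩ := h ℓ₀ h₀
    generalize E ℓ₀ = F at hs
    cases hp
    cases hs
  | done a e =>
    obtain ⟨P, hp, hs⟩ := h ℓ₀ h₀
    generalize E ℓ₀ = F at hs
    cases hp with
    | done => cases hs; cases hl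
    | done_ne => cases hs
  | send a e b C ih =>
    -- The view of the sender `a` starts with a send, whose steps never carry a β-label. The cases
    -- of `if` and of synchronization are alike.
    obtain ⟨P, hp, hs⟩ := h a (hL (by simp [Chor.locationNames]))
    generalize E a = F at hs
    cases hp with
    | send => cases hs <;> cases hl
    | recv => contradiction
    | send_ne h => exact (h rfl).elim
  | ite a e C₁ C₂ =>
    obtain ⟨P, hp, hs⟩ := h a (hL (by simp [Chor.locationNames]))
    generalize E a = F at hs
    cases hp with
    | ite => cases hs <;> cases hl
    | ite_ne h => exact (h rfl).elim
  | sync a d b C =>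
    obtain ⟨P, hp, hs⟩ := h a (hL (by simp [Chor.locationNames]))
    generalize E a = F at hs
    cases hp with
    | choose => cases hs; cases hl
    | allowL => contradiction
    | allowR => contradiction
    | sync_ne h => exact (h rfl).elim
  | funLocal a C =>
    obtain ⟨P, hp, hs⟩ := h ℓ₀ h₀
    generalize E ℓ₀ = F at hs
    cases hp <;> cases hs
  | funGlobal C =>
    obtain ⟨P, hp, hs⟩ := h ℓ₀ h₀
    generalize E ℓ₀ = F at hs
    cases hp
    cases hs
  | defLocal a C₁ C₂ ih =>
    have ha : a ∈ 𝔏 := hL (by simp [Chor.locationNames])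
    have hL₁ : C₁.locationNames ⊆ 𝔏 := fun x hx => hL (.inl (.inr hx))
    cases hl with
    | func =>
      obtain ⟨P, hp, hs⟩ := h a ha
      cases hp with
      | defLocal => cases hs
      | defLocal_ne h => exact (h rfl).elim
    | @arg l _ _ hl =>
      -- Collects the results of the inner steps into a single function on all locations, with a
      -- dummy value outside `𝔏`, together with a way to rebuild the projection of the whole term
      -- around the new subterm.
      have key : ∀ ℓ, ∃ E', ℓ ∈ 𝔏 → (∃ P, Projects ℓ C₁ P ∧ CtrlStep l P E') ∧
          ∀ C', Projects ℓ C' E' → Projects ℓ (.defLocal a C' C₂) (E ℓ) := by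
        intro ℓ
        by_cases hℓ : ℓ ∈ 𝔏
        · obtain ⟨P, hp, hs⟩ := h ℓ hℓ
          generalize E ℓ = F at hs
          cases hp with
          | defLocal hp hp₂ =>
            cases hs with
            | letRetArg hs => exact ⟨_, fun _ => ⟨⟨_, hp, hs⟩, fun _ h => .defLocal h hp₂⟩⟩
          | defLocal_ne hn hp hp₂ =>
            cases hs with
            | appGlobalArg hs =>
              exact ⟨_, fun _ => ⟨⟨_, hp, hs⟩, fun _ h => .defLocal_ne hn h hp₂⟩⟩
        · exact ⟨.unit, fun h => (hℓ h).elim⟩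
      choose E' hE' using key
      obtain ⟨R, C', hR, hC, t⟩ := ih hl hL₁ fun ℓ hℓ => (hE' ℓ hℓ).1
      exact ⟨.arg R, .defLocal a C' C₂, fun ℓ hℓ => by simp [Redex.project, hR ℓ hℓ],
        fun ℓ hℓ => (hE' ℓ hℓ).2 _ (hC ℓ hℓ), .defLocalI t⟩
    | sync =>
      have hv : C₁.IsValue := Chor.isValue_of_projects hne hL₁ fun ℓ hℓ => by
        obtain ⟨P, hp, hs⟩ := h ℓ hℓ
        generalize E ℓ = F at hs
        cases hp with
        | defLocal hp => cases hs with | letRet hv => exact ⟨_, hp, .ret _ hv⟩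
        | defLocal_ne _ hp => cases hs with | appGlobal hv => exact ⟨_, hp, hv⟩
      -- Among choreography values, only a local value at `a` itself looks like a returned value to
      -- `a`.
      have hd : ∃ v, L.IsValue v ∧ C₁ = .done a v := by
        obtain ⟨P, hp, hs⟩ := h a ha
        generalize E a = F at hs
        cases hp with
        | defLocal hp =>
          cases hs with | letRet hv' =>
          cases hv <;> cases hp
          exact ⟨_, hv', rfl⟩
        | defLocal_ne h => exact (h rfl).elim
      clear hv
      obtain ⟨v, hv, rfl⟩ := hd
      refine ⟨.defLocal a v, _, fun _ _ => rfl, fun ℓ hℓ => ?_, .defLocal hv⟩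
      obtain ⟨P, hp, hs⟩ := h ℓ hℓ
      generalize E ℓ = F at hs
      cases hp with
      | defLocal hp hp₂ =>
        cases hs with | letRet =>
        cases hp with
        | done => exact hp₂.localSubst _
      | defLocal_ne hn _ hp₂ =>
        cases hs with | appGlobal =>
        -- Both variables of the projected function are fresh, so the substitution is the identity
        -- after the shift by two: this location sees no effect of the binding at `a`.
        rw [Ctrl.subst_rename]
        exact (Ctrl.subst_var (Loc := Loc) (L := L) _).symm ▸ hp₂.localSubst_ne hn _
  | appLocal a C₁ e ih =>
    have ha : a ∈ 𝔏 := hL (by simp [Chor.locationNames])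
    have hL₁ : C₁.locationNames ⊆ 𝔏 := fun x hx => hL (.inr hx)
    cases hl with
    | arg =>
      obtain ⟨P, hp, hs⟩ := h a ha
      cases hp with
      | appLocal => cases hs
      | appLocal_ne h => exact (h rfl).elim
    | @func l _ _ hl =>
      have key : ∀ ℓ, ∃ E', ℓ ∈ 𝔏 → (∃ P, Projects ℓ C₁ P ∧ CtrlStep l P E') ∧
          ∀ C', Projects ℓ C' E' → Projects ℓ (.appLocal a C' e) (E ℓ) := by
        intro ℓ
        by_cases hℓ : ℓ ∈ 𝔏
        · obtain ⟨P, hp, hs⟩ := h ℓ hℓ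
          generalize E ℓ = F at hs
          cases hp with
          | appLocal hp =>
            cases hs with
            | appLocalFun hs => exact ⟨_, fun _ => ⟨⟨_, hp, hs⟩, fun _ h => .appLocal h⟩⟩
          | appLocal_ne hn hp =>
            cases hs with
            | appGlobalFun hs => exact ⟨_, fun _ => ⟨⟨_, hp, hs⟩, fun _ h => .appLocal_ne hn h⟩⟩
        · exact ⟨.unit, fun h => (hℓ h).elim⟩
      choose E' hE' using key
      obtain ⟨R, C', hR, hC, t⟩ := ih hl hL₁ fun ℓ hℓ => (hE' ℓ hℓ).1
      exact ⟨.func R, .appLocal a C' e, fun ℓ hℓ => by simp [Redex.project, hR ℓ hℓ],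
        fun ℓ hℓ => (hE' ℓ hℓ).2 _ (hC ℓ hℓ), .appLocalFun t⟩
    | sync =>
      -- The view of `a` alone does not show that `C₁` is a function, as `a` could have skipped a
      -- prefix before it; all views together do.
      have hi := Chor.cases_of_projects_isIntro hne hL₁ fun ℓ hℓ => by
        obtain ⟨P, hp, hs⟩ := h ℓ hℓ
        generalize E ℓ = F at hs
        cases hp with
        | appLocal hp => cases hs with | appLocal => exact ⟨_, hp, trivial⟩
        | appLocal_ne _ hp => cases hs with | appGlobal => exact ⟨_, hp, trivial⟩
      have hd : L.IsValue e ∧ ∃ D, C₁ = .funLocal a D := by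
        obtain ⟨P, hp, hs⟩ := h a ha
        generalize E a = F at hs
        cases hp with
        | appLocal hp =>
          cases hs with | appLocal hv =>
          refine ⟨hv, ?_⟩
          rcases hi with ⟨_, _, rfl⟩ | ⟨_, _, rfl⟩ | ⟨_, rfl⟩ <;> cases hp
          exact ⟨_, rfl⟩
        | appLocal_ne h => exact (h rfl).elim
      obtain ⟨hv, D, rfl⟩ := hd
      refine ⟨.appLocal a e, _, fun _ _ => rfl, fun ℓ hℓ => ?_, .appLocal hv⟩
      obtain ⟨P, hp, hs⟩ := h ℓ hℓ
      generalize E ℓ = F at hs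
      cases hp with
      | appLocal hp =>
        cases hs with | appLocal =>
        cases hp with
        | funLocal hp => exact (hp.localSubst _).subst (Projects.funLocal hp).single
      | appLocal_ne hn hp =>
        cases hs with | appGlobal =>
        cases hp with
        | funLocal_ne _ hp =>
          -- The shift by one drops the unit argument from the double substitution; what remains
          -- sends variable `0` to the function itself, as `Chor.single` does in the choreography.
          rw [Ctrl.subst_rename]
          refine (hp.localSubst_ne hn _).subst fun n => ?_
          cases n with
          | zero => exact .funLocal_ne hn hp
          | succ n => exact .var
  | appGlobal C₁ C₂ ih₁ ih₂ =>
    have hL₁ : C₁.locationNames ⊆ 𝔏 := fun x hx => hL (.inl hx)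
    have hL₂ : C₂.locationNames ⊆ 𝔏 := fun x hx => hL (.inr hx)
    cases hl with
    | @func l _ _ hl =>
      have key : ∀ ℓ, ∃ E', ℓ ∈ 𝔏 → (∃ P, Projects ℓ C₁ P ∧ CtrlStep l P E') ∧
          ∀ C', Projects ℓ C' E' → Projects ℓ (.appGlobal C' C₂) (E ℓ) := by
        intro ℓ
        by_cases hℓ : ℓ ∈ 𝔏
        · obtain ⟨P, hp, hs⟩ := h ℓ hℓ
          generalize E ℓ = F at hs
          cases hp with | appGlobal hp hp₂ =>
          cases hs with | appGlobalFun hs =>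
          exact ⟨_, fun _ => ⟨⟨_, hp, hs⟩, fun _ h => .appGlobal h hp₂⟩⟩
        · exact ⟨.unit, fun h => (hℓ h).elim⟩
      choose E' hE' using key
      obtain ⟨R, C', hR, hC, t⟩ := ih₁ hl hL₁ fun ℓ hℓ => (hE' ℓ hℓ).1
      exact ⟨.func R, .appGlobal C' C₂, fun ℓ hℓ => by simp [Redex.project, hR ℓ hℓ],
        fun ℓ hℓ => (hE' ℓ hℓ).2 _ (hC ℓ hℓ), .appGlobalFun t⟩
    | @arg l _ _ hl =>
      have key : ∀ ℓ, ∃ E', ℓ ∈ 𝔏 → (∃ P, Projects ℓ C₂ P ∧ CtrlStep l P E') ∧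
          ∀ C', Projects ℓ C' E' → Projects ℓ (.appGlobal C₁ C') (E ℓ) := by
        intro ℓ
        by_cases hℓ : ℓ ∈ 𝔏
        · obtain ⟨P, hp, hs⟩ := h ℓ hℓ
          generalize E ℓ = F at hs
          cases hp with | appGlobal hp hp₂ =>
          cases hs with | appGlobalArg hs =>
          exact ⟨_, fun _ => ⟨⟨_, hp₂, hs⟩, fun _ h => .appGlobal hp h⟩⟩
        · exact ⟨.unit, fun h => (hℓ h).elim⟩
      choose E' hE' using key
      obtain ⟨R, C', hR, hC, t⟩ := ih₂ hl hL₂ fun ℓ hℓ => (hE' ℓ hℓ).1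
      exact ⟨.arg R, .appGlobal C₁ C', fun ℓ hℓ => by simp [Redex.project, hR ℓ hℓ],
        fun ℓ hℓ => (hE' ℓ hℓ).2 _ (hC ℓ hℓ), .appGlobalArg t⟩
    | sync =>
      have hβ : ∀ ℓ ∈ 𝔏, ∃ F V, Projects ℓ C₁ (.funGlobal F) ∧ Projects ℓ C₂ V ∧ V.IsValue ∧
          E ℓ = F.subst (Ctrl.double V (.funGlobal F)) := by
        intro ℓ hℓ
        obtain ⟨P, hp, hs⟩ := h ℓ hℓ
        generalize E ℓ = G at hs ⊢
        cases hp with | appGlobal hp hp₂ =>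
        cases hs with | appGlobal hv => exact ⟨_, _, hp, hp₂, hv, rfl⟩
      have hv : C₂.IsValue := Chor.isValue_of_projects hne hL₂ fun ℓ hℓ => by
        obtain ⟨_, V, _, hp, hv, _⟩ := hβ ℓ hℓ
        exact ⟨V, hp, hv⟩
      have hi := Chor.cases_of_projects_isIntro hne hL₁ fun ℓ hℓ => by
        obtain ⟨F, _, hp, _⟩ := hβ ℓ hℓ
        exact ⟨_, hp, trivial⟩
      rcases hi with ⟨a, _, rfl⟩ | ⟨a, _, rfl⟩ | ⟨D, rfl⟩
      · obtain ⟨F, _, hp, _⟩ := hβ ℓ₀ h₀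
        cases hp
      -- Other locations see a function local to `a` as a global one, but `a` does not, and `a` lies
      -- in `𝔏`.
      · obtain ⟨F, _, hp, _⟩ := hβ a (hL (by simp [Chor.locationNames]))
        cases hp with | funLocal_ne h => exact (h rfl).elim
      · refine ⟨.appGlobal, _, fun _ _ => rfl, fun ℓ hℓ => ?_, .appGlobal hv⟩
        obtain ⟨F, V, hp, hp₂, _, hE⟩ := hβ ℓ hℓ
        rw [hE]
        cases hp with
        | funGlobal hp => exact hp.subst (hp₂.double (.funGlobal hp))

end Pirouette

theorem mainTheorem4 {Loc : Type u} {L : Pirouette.LocalLanguage.{v}} :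
    -- internal steps
    (∀ (C₁ : Pirouette.Chor Loc L) (ℓ : Loc) (l : Pirouette.Label Loc L)
        (P E : Pirouette.Ctrl Loc L),
      C₁.project ℓ = some P → Pirouette.CtrlStep l P E → Pirouette.LabelMerge l l .iota →
      ∃ (R : Pirouette.Redex Loc L) (C₂ : Pirouette.Chor Loc L),
        R.project ℓ = some l ∧ C₂.project ℓ = some E ∧ Pirouette.ChorStep R ∅ C₁ C₂) ∧
    -- matched send and receive
    (∀ (C₁ : Pirouette.Chor Loc L) (ℓ₁ ℓ₂ : Loc) (v : L.Expr) (l₁ l₂ : Pirouette.Label Loc L)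
        (P₁ P₂ E₁ E₂ : Pirouette.Ctrl Loc L),
      C₁.project ℓ₁ = some P₁ → C₁.project ℓ₂ = some P₂ →
      Pirouette.CtrlStep l₁ P₁ E₁ → Pirouette.CtrlStep l₂ P₂ E₂ →
      Pirouette.LabelMerge l₁ l₂ (.comm ℓ₁ v ℓ₂) →
      ∃ (R : Pirouette.Redex Loc L) (C₂ : Pirouette.Chor Loc L),
        C₂.project ℓ₁ = some E₁ ∧ C₂.project ℓ₂ = some E₂ ∧
        R.project ℓ₁ = some l₁ ∧ R.project ℓ₂ = some l₂ ∧ Pirouette.ChorStep R ∅ C₁ C₂) ∧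
    -- matched choice
    (∀ (C₁ : Pirouette.Chor Loc L) (ℓ₁ ℓ₂ : Loc) (d : Pirouette.SyncLabel)
        (l₁ l₂ : Pirouette.Label Loc L) (P₁ P₂ E₁ E₂ : Pirouette.Ctrl Loc L),
      C₁.project ℓ₁ = some P₁ → C₁.project ℓ₂ = some P₂ →
      Pirouette.CtrlStep l₁ P₁ E₁ → Pirouette.CtrlStep l₂ P₂ E₂ →
      Pirouette.LabelMerge l₁ l₂ (.choice ℓ₁ d ℓ₂) →
      ∃ (R : Pirouette.Redex Loc L) (C₂ : Pirouette.Chor Loc L),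
        C₂.project ℓ₁ = some E₁ ∧ C₂.project ℓ₂ = some E₂ ∧
        R.project ℓ₁ = some l₁ ∧ R.project ℓ₂ = some l₂ ∧ Pirouette.ChorStep R ∅ C₁ C₂) ∧
    -- synchronized β-steps
    (∀ (C₁ : Pirouette.Chor Loc L) (𝔏 : Set Loc) (l : Pirouette.Label Loc L)
        (P E : Loc → Pirouette.Ctrl Loc L),
      C₁.locationNames ⊆ 𝔏 → 𝔏 ≠ ∅ → Pirouette.LabelMerge l l .syncIota →
      (∀ ℓ ∈ 𝔏, C₁.project ℓ = some (P ℓ) ∧ Pirouette.CtrlStep l (P ℓ) (E ℓ)) →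
      ∃ (R : Pirouette.Redex Loc L) (C₂ : Pirouette.Chor Loc L),
        (∀ ℓ ∈ 𝔏, R.project ℓ = some l) ∧ (∀ ℓ ∈ 𝔏, C₂.project ℓ = some (E ℓ)) ∧
        Pirouette.ChorStep R ∅ C₁ C₂) := by
  refine ⟨?_, ?_, ?_, ?_⟩
  · intro C₁ ℓ l P E hP hs hl
    obtain ⟨R, hr, hR, hp⟩ := hs.redexStep_of_iota ℓ hl
    obtain ⟨C₂, hC, t⟩ := (Pirouette.project_eq_some_iff.1 hP).exists_chorStep_of_isLocal hr hR
      (Set.notMem_empty ℓ)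
    exact ⟨R, C₂, hp, Pirouette.project_eq_some_iff.2 hC, t⟩
  · intro C₁ ℓ₁ ℓ₂ v l₁ l₂ P₁ P₂ E₁ E₂ h₁ h₂ s₁ s₂ hl
    exact hl.exists_chorStep ⟨rfl, rfl⟩ h₁ h₂ s₁ s₂
  · intro C₁ ℓ₁ ℓ₂ d l₁ l₂ P₁ P₂ E₁ E₂ h₁ h₂ s₁ s₂ hl
    exact hl.exists_chorStep ⟨rfl, rfl⟩ h₁ h₂ s₁ s₂
  · intro C₁ 𝔏 l P E hL hne hl h
    simp only [Pirouette.project_eq_some_iff] at h ⊢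
    exact hl.exists_chorStep_of_syncIota (Set.nonempty_iff_ne_empty.2 hne) hL
      fun ℓ hℓ => ⟨P ℓ, h ℓ hℓ⟩
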